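/- Consider a bandit problem with a finite set $\mathcal A$ of $N\ge 2$ arms and independent rewards $R_a(t)$, $a\in\mathcal A$, $t\in\{0,1,2,\dots\}$, where $R_a(t)$ is Bernoulli with mean $r_a\in[0,1]$. Let $r^\star=\max_a r_a$, suppose that the maximizer $a^\star$ is unique, and let $\Delta=r^\star-\max_{a\ne a^\star}r_a>0$. Let $\beta\in(0,1]$ and $\alpha(p)=\beta/(1-\log p)$. The SAMBA process $\bm p(t)=(p_a(t):a\in\mathcal A)$ with learning rate $\alpha$ starts from a fixed probability vector $\bm p(0)$ with positive entries and evolves as follows. At time $t$, given the past, an arm is played that is drawn from the distribution $\bm p(t)$; let $I_a(t)$ be the indicator that it is arm $a$. A leading arm $a_\star(t)$ is selected, independently, uniformly at random among the maximizers of $a\mapsto p_a(t)$. The rewards at time $t$ are independent of the past and of these selections. Then $$p_a(t+1)=p_a(t)+\alpha(p_a(t))\,p_a(t)^2\left[\frac{I_a(t)R_a(t)}{p_a(t)}-\frac{I_{a_\star(t)}(t)R_{a_\star(t)}(t)}{p_{a_\star(t)}(t)}\right]\quad (a\ne a_\star(t)),$$ and $p_{a_\star(t)}(t+1)=1-\sum_{a\ne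 a_\star(t)}p_a(t+1)$. The regret is $\mathcal Rg(T)=r^\star T-\mathbb E\big[\sum_{t=0}^{T-1}\sum_{a}I_a(t)R_a(t)\big]$. Then $(\bm p(t))_{t\ge 0}$ is a Markov chain on the set of probability vectors on $\mathcal A$ with positive entries (with the transition law given by the above rule), $p_{a^\star}(t)\to 1$ as $t\to\infty$ with probability $1$, $Q:=\sum_{t=0}^\infty\mathbb P\big(p_{a^\star}(t)\le\tfrac12\big)<\infty$, and for every integer $T\ge 1$ $$\mathcal Rg(T)\le\frac{N}{2\beta\Delta}\big(\log(\beta\Delta T)\big)^2+Q+\Big\lceil\frac{e}{\beta\Delta}\Big\rceil .$$ -/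

import Mathlib

open MeasureTheory ProbabilityTheory Filter Topology
open scoped BigOperators

noncomputable section

namespace Samba

variable {ι Ω : Type*}

section Bandit

variable [Fintype ι]

/-- The gap between the mean reward of the arm `aStar` and the best mean reward of the
other arms. -/
def gap (r : ι → ℝ) (aStar : ι) : ℝ :=
  r aStar - ⨆ a : {a : ι // a ≠ aStar}, r a

open Classical in
/-- The indicator that arm `a` is played at time `t`, where `A t` is the arm played. -/
def played (A : ℕ → Ω → ι) (t : ℕ) (a : ι) (ω : Ω) : ℝ :=
  if A t ω = a then 1 else 0

/-- The regret by time `T`: the expected reward of always playing the best arm minus the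
expected cumulative reward collected at times `0, …, T - 1`. -/
def regret [MeasurableSpace Ω] (μ : Measure Ω) (r : ι → ℝ) (R : ℕ → ι → Ω → ℝ)
    (A : ℕ → Ω → ι) (T : ℕ) : ℝ :=
  (⨆ a, r a) * T - ∫ ω, ∑ t ∈ Finset.range T, ∑ a, played A t a ω * R t a ω ∂μ

/-- `(R t a)` are independent rewards, and `R t a` is Bernoulli with mean `r a`. -/
structure IsRewardProcess [MeasurableSpace Ω] (μ : Measure Ω) (r : ι → ℝ)
    (R : ℕ → ι → Ω → ℝ) : Prop where
  measurable : ∀ t a, Measurable (R t a)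
  prob_one : ∀ t a, μ.real {ω | R t a ω = 1} = r a
  prob_zero : ∀ t a, μ.real {ω | R t a ω = 0} = 1 - r a
  indep : iIndepFun (fun i : ℕ × ι => R i.1 i.2) μ

end Bandit

section Algorithm

variable [Fintype ι]

/-- The probability vectors on the arms all of whose entries are positive. -/
def openSimplex (ι : Type*) [Fintype ι] : Set (ι → ℝ) :=
  {p | (∀ a, 0 < p a) ∧ ∑ a, p a = 1}

open Classical in
/-- The set of arms of maximal probability. -/
def leaders (p : ι → ℝ) : Finset ι :=
  Finset.univ.filter fun l => ∀ b, p b ≤ p l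

open Classical in
/-- The probability that `l` is selected as leading arm: uniform among the maximizers. -/
def leaderProb (p : ι → ℝ) (l : ι) : ℝ :=
  if l ∈ leaders p then ((leaders p).card : ℝ)⁻¹ else 0

/-- The new probability of an arm `a` that is not the leading arm `l`; the vector `z` holds the
observed data, that is `z a` is the play indicator of `a` times the reward of `a`. The learning
rate for arm `a` is the function `α` evaluated at the current probability of `a`. -/
def updateOther (α : ℝ → ℝ) (p : ι → ℝ) (l : ι) (z : ι → ℝ) (a : ι) : ℝ :=
  p a + α (p a) * p a ^ 2 * (z a / p a - z l / p l)

open Classical in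
/-- One step of the algorithm: arms other than the leading arm `l` are updated by
`updateOther`, and the leading arm receives the remaining probability. -/
def update (α : ℝ → ℝ) (p : ι → ℝ) (l : ι) (z : ι → ℝ) (a : ι) : ℝ :=
  if a = l then 1 - ∑ b ∈ Finset.univ.filter (fun b => b ≠ l), updateOther α p l z b
  else updateOther α p l z a

/-- The vector of probabilities at time `t`, started from `p₀`, when `R` are the rewards,
`A s` is the arm played and `L s` is the leading arm selected at time `s`. -/
def prob (α : ℝ → ℝ) (p₀ : ι → ℝ) (R : ℕ → ι → Ω → ℝ) (A L : ℕ → Ω → ι) :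
    ℕ → Ω → ι → ℝ
  | 0, _ => p₀
  | t + 1, ω =>
      update α (prob α p₀ R A L t ω) (L t ω) (fun a => played A t a ω * R t a ω)

/-- The information available before time `t`: for each `s < t` the arm played, the reward
received from it, and the leading arm selected. -/
abbrev history [MeasurableSpace ι] (R : ℕ → ι → Ω → ℝ) (A L : ℕ → Ω → ι) (t : ℕ) :
    MeasurableSpace Ω :=
  ⨆ s : Fin t, (MeasurableSpace.comap (A s) inferInstance ⊔
    MeasurableSpace.comap (L s) inferInstance ⊔
    MeasurableSpace.comap (fun ω => R s (A s ω) ω) inferInstance)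

/-- `(R, A, L)` is a run of SAMBA with learning rate function `α`, mean rewards `r` and initial
probabilities `p₀`: given the history, the arm played is drawn from the current probability
vector and, independently, the leading arm is drawn uniformly among the arms of maximal
probability; the rewards of time `t` are independent of the history and of these draws. -/
structure IsSamba [MeasurableSpace ι] [MeasurableSpace Ω] (μ : Measure Ω) (r : ι → ℝ)
    (α : ℝ → ℝ) (p₀ : ι → ℝ) (R : ℕ → ι → Ω → ℝ) (A L : ℕ → Ω → ι) : Prop where
  rewards : IsRewardProcess μ r R
  measurable_arm : ∀ t, Measurable (A t)
  measurable_leader : ∀ t, Measurable (L t)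
  choice : ∀ t a l, μ⟦{ω | A t ω = a ∧ L t ω = l} | history R A L t⟧ =ᵐ[μ]
    fun ω => prob α p₀ R A L t ω a * leaderProb (prob α p₀ R A L t ω) l
  rewards_indep : ∀ t, Indep (⨆ a, MeasurableSpace.comap (R t a) inferInstance)
    (history R A L t ⊔ MeasurableSpace.comap (A t) inferInstance ⊔
      MeasurableSpace.comap (L t) inferInstance) μ

open Classical in
/-- The transition law of the SAMBA probabilities: from `p`, the arm `a` is played with
probability `p a`, the leading arm is `l` with probability `leaderProb p l`, and the played arm
yields reward `1` with probability `r a` and reward `0` otherwise. -/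
def transition (r : ι → ℝ) (α : ℝ → ℝ) (p : ι → ℝ) : Measure (ι → ℝ) :=
  ∑ a, ∑ l, ENNReal.ofReal (p a * leaderProb p l) •
    (ENNReal.ofReal (r a) • Measure.dirac (update α p l (Pi.single a 1)) +
      ENNReal.ofReal (1 - r a) • Measure.dirac (update α p l 0))

/-- The learning rate function `β / (1 - log p)`. -/
def logRate (β : ℝ) (x : ℝ) : ℝ := β / (1 - Real.log x)

end Algorithm

/-- `X` is a (time-homogeneous) Markov chain with state space `S` and transition kernel `κ`:
`κ` is measurable, `κ x` is a probability measure carried by `S` for each `x ∈ S`, the chain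
stays in `S`, and the conditional law of `X (t + 1)` given `X 0, …, X t` is `κ (X t)`. -/
structure IsMarkovChain {E : Type*} [MeasurableSpace E] [MeasurableSpace Ω] (μ : Measure Ω)
    (S : Set E) (κ : E → Measure E) (X : ℕ → Ω → E) : Prop where
  measurableSet_state : MeasurableSet S
  measurable_kernel : Measurable κ
  kernel_prob : ∀ x ∈ S, IsProbabilityMeasure (κ x)
  kernel_state : ∀ x ∈ S, κ x Sᶜ = 0
  measurable : ∀ t, Measurable (X t)
  mem_state : ∀ᵐ ω ∂μ, ∀ t, X t ω ∈ S
  markov : ∀ t B, MeasurableSet B →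
    μ⟦X (t + 1) ⁻¹' B | ⨆ s : Fin (t + 1), MeasurableSpace.comap (X s) inferInstance⟧ =ᵐ[μ]
      fun ω => (κ (X t ω)).real B

end Samba

end

/-!
# Regret of SAMBA with learning rate `β / (1 - log p)`

Write `x = p s` for the probability of the best arm `s`, `q = 1 - x`, and `Δ` for the gap. Since
the rule divides each reward by the probability of playing the arm, `x` increases in mean at every
step: by at least `Δ * ∑ α (p b) * p b ^ 2`, summed over the other arms, while `s` leads, and by
at least `Δ * α x * x ^ 2` while another arm leads.

*Time spent below `1 / 2`.* The function `1 / x ^ 2 + K * (1 - x)` with large `K` is a Lyapunov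
function (`exists_lyapunov`). Its second-order term is dominated by the drift of `x`, except near
`x = 0`; there the rate `α x` is small, so that the drift of `1 / x ^ 2` itself is negative, of
size `α x / x ≥ β`. Hence it decreases in mean at a positive rate while `x ≤ 1 / 2`, and the
expected time spent there is finite. By Borel-Cantelli `x > 1 / 2` eventually. The total
expected increase of `x` is at most `1`, so the increments are summable almost surely, and each
other `p b` tends to `0`.

*Regret.* The regret is at most the sum of the means of `q`, and the times with `x ≤ 1 / 2`
contribute at most the expected time spent there. Only the visits of the region `x > 1 / 2`
remain. Since `q` is a supermartingale, its mean `x_k` at the visit number `k` satisfies, with `n`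
the number of the other arms, `x_{k+1} ≤ x_k - β * Δ * n * G (x_k / n)`, where
`G y = y ^ 2 / (1 - log y)` is convex (Jensen's inequality both over the arms and over the
probability space, carried out with the tangent lines of `tangent_le`). For `w = x_k / n` the
function `-log w / w` has derivative `-(1 - log w) / w ^ 2`, so it grows by at least `β * Δ` per
visit. Therefore `w ≤ log (β Δ k) / (β Δ k)` once `β Δ k ≥ e`, and the sum over the visits is of
the order of `log ^ 2` (`sum_recursion_le`).
-/

noncomputable section

namespace Samba

/-! ### The learning rate -/

section Rate

variable {β x : ℝ}

lemma logRate_pos (hβ : 0 < β) (hx : 0 < x) (hx1 : x ≤ 1) : 0 < logRate β x := by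
  have := Real.log_nonpos hx.le hx1
  exact div_pos hβ (by linarith)

lemma logRate_le_one (hβ : β ≤ 1) (hx : 0 < x) (hx1 : x ≤ 1) :
    logRate β x ≤ 1 := by
  have := Real.log_nonpos hx.le hx1
  exact (div_le_one (by linarith)).2 (by linarith)

lemma logRate_le_two_thirds (hβ : β ≤ 1) (hx : 0 < x) (hx1 : x ≤ 1 / 2) :
    logRate β x ≤ 2 / 3 := by
  have h1 := Real.log_le_log hx hx1
  have h2 : Real.log (1 / 2) = -Real.log 2 := by rw [one_div, Real.log_inv]
  have h3 := Real.log_two_gt_d9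
  rw [logRate, div_le_iff₀ (by linarith)]
  linarith

/-- Since `x * (1 - log x) ≤ 1`, the rate dominates a linear function. -/
lemma mul_le_logRate (hβ : 0 < β) (hx : 0 < x) (hx1 : x ≤ 1) : β * x ≤ logRate β x := by
  have h1 := Real.log_nonpos hx.le hx1
  have h2 := Real.log_le_sub_one_of_pos (inv_pos.2 hx)
  rw [Real.log_inv] at h2
  have h3 : x * (1 - Real.log x) ≤ 1 := by
    calc x * (1 - Real.log x) ≤ x * x⁻¹ := by
          apply mul_le_mul_of_nonneg_left _ hx.le; linarith
      _ = 1 := mul_inv_cancel₀ hx.ne'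
  rw [logRate, le_div_iff₀ (by linarith)]
  nlinarith

/-- The rate vanishes at `0`, so it is eventually below any level; away from `0` it is absorbed
by a multiple of `x ^ 3`. -/
lemma exists_logRate_le (hβ : β ≤ 1) {δ : ℝ} (hδ : 0 < δ) :
    ∃ K : ℝ, 0 ≤ K ∧ ∀ x, 0 < x → x ≤ 1 → logRate β x ≤ δ + K * x ^ 3 := by
  refine ⟨(Real.exp (1 - 1 / δ) ^ 3)⁻¹, by positivity, fun x hx hx1 => ?_⟩
  rcases le_total x (Real.exp (1 - 1 / δ)) with h | h
  · have h1 : Real.log x ≤ 1 - 1 / δ := (Real.log_le_iff_le_exp hx).2 h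
    have h2 : 0 < 1 / δ := by positivity
    have h3 : logRate β x ≤ δ := by
      rw [logRate, div_le_iff₀ (by linarith)]
      calc β ≤ δ * (1 / δ) := by rw [mul_one_div_cancel hδ.ne']; exact hβ
        _ ≤ _ := by apply mul_le_mul_of_nonneg_left _ hδ.le; linarith
    have : 0 ≤ (Real.exp (1 - 1 / δ) ^ 3)⁻¹ * x ^ 3 := by positivity
    linarith
  · have h1 := logRate_le_one hβ hx hx1
    have h2 : 1 ≤ (Real.exp (1 - 1 / δ) ^ 3)⁻¹ * x ^ 3 := by
      rw [inv_mul_eq_div, one_le_div (by positivity)]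
      gcongr
    linarith

end Rate

/-! ### One step of the algorithm -/

section Step

variable {ι : Type*} [Fintype ι] {β : ℝ} {p : ι → ℝ} {l : ι}

lemma mem_leaders : l ∈ leaders p ↔ ∀ b, p b ≤ p l := by
  simp [leaders]

lemma leaders_nonempty [Nonempty ι] (p : ι → ℝ) : (leaders p).Nonempty := by
  obtain ⟨l, hl⟩ := Finite.exists_max p
  exact ⟨l, mem_leaders.2 hl⟩

lemma leaderProb_nonneg (p : ι → ℝ) (l : ι) : 0 ≤ leaderProb p l := by
  unfold leaderProb; split_ifs <;> positivity

lemma leaderProb_of_notMem (h : l ∉ leaders p) : leaderProb p l = 0 := if_neg h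

lemma sum_leaderProb [Nonempty ι] (p : ι → ℝ) : ∑ l, leaderProb p l = 1 := by
  classical
  unfold leaderProb
  rw [Finset.sum_ite_mem, Finset.univ_inter, Finset.sum_const, nsmul_eq_mul]
  exact mul_inv_cancel₀ (by exact_mod_cast (leaders_nonempty p).card_pos.ne')

namespace openSimplex

lemma pos (hp : p ∈ openSimplex ι) (a : ι) : 0 < p a := hp.1 a

open Classical in
lemma sum_erase (hp : p ∈ openSimplex ι) (a : ι) :
    ∑ b ∈ Finset.univ.erase a, p b = 1 - p a := by
  rw [← hp.2, ← Finset.add_sum_erase _ _ (Finset.mem_univ a)]; ring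

lemma le_one (hp : p ∈ openSimplex ι) (a : ι) : p a ≤ 1 := by
  rw [← hp.2]
  exact Finset.single_le_sum (fun b _ => (hp.1 b).le) (Finset.mem_univ a)

lemma add_le_one (hp : p ∈ openSimplex ι) {a b : ι} (hab : a ≠ b) : p a + p b ≤ 1 := by
  classical
  have h := sum_erase hp b
  have := Finset.single_le_sum (f := p) (fun b _ => (hp.1 b).le)
    (Finset.mem_erase.2 ⟨hab, Finset.mem_univ a⟩)
  linarith

lemma le_half (hp : p ∈ openSimplex ι) (hl : l ∈ leaders p) {a : ι} (ha : a ≠ l) :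
    p a ≤ 1 / 2 := by
  have := add_le_one hp ha
  have := mem_leaders.1 hl a
  linarith

lemma leaders_eq (hp : p ∈ openSimplex ι) {a : ι} (ha : 1 / 2 < p a) (hl : l ∈ leaders p) :
    l = a := by
  by_contra h
  have := le_half hp hl (Ne.symm h)
  linarith

end openSimplex

open openSimplex

open Classical in
/-- The total squared mass `∑ α (p b) * p b ^ 2` of the arms other than `l`; up to gaps in the
rewards it is the expected increase of the probability of `l` while `l` is leading. -/
def spread (α : ℝ → ℝ) (p : ι → ℝ) (l : ι) : ℝ :=
  ∑ b ∈ Finset.univ.erase l, α (p b) * p b ^ 2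

lemma update_of_ne (α : ℝ → ℝ) (z : ι → ℝ) {a : ι} (h : a ≠ l) :
    update α p l z a = p a + α (p a) * p a ^ 2 * (z a / p a - z l / p l) := by
  simp [update, h, updateOther]

open Classical in
lemma update_leader (α : ℝ → ℝ) (hp : p ∈ openSimplex ι) (z : ι → ℝ) :
    update α p l z l = p l - ∑ b ∈ Finset.univ.erase l, α (p b) * p b * z b
      + z l / p l * spread α p l := by
  have h : ∀ b, updateOther α p l z b
      = p b + (α (p b) * p b * z b - z l / p l * (α (p b) * p b ^ 2)) := by
    intro b
    have := (pos hp b).ne'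
    rw [updateOther]; field_simp
  rw [update, if_pos rfl, Finset.filter_ne', Finset.sum_congr rfl (fun b _ => h b),
    Finset.sum_add_distrib, sum_erase hp, Finset.sum_sub_distrib, ← Finset.mul_sum, spread]
  ring

lemma update_zero (α : ℝ → ℝ) (hp : p ∈ openSimplex ι) (l : ι) : update α p l 0 = p := by
  classical
  funext a
  by_cases h : a = l
  · subst h; rw [update_leader α hp]; simp
  · rw [update_of_ne α _ h]; simp

open Classical in
lemma update_leader_single_self (α : ℝ → ℝ) (hp : p ∈ openSimplex ι) :
    update α p l (Pi.single l 1) l = p l + spread α p l / p l := by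
  rw [update_leader α hp, Finset.sum_eq_zero]
  · simp; ring
  · intro b hb
    rw [Pi.single_eq_of_ne (Finset.ne_of_mem_erase hb), mul_zero]

open Classical in
lemma update_leader_single_of_ne (α : ℝ → ℝ) (hp : p ∈ openSimplex ι) {a : ι} (h : a ≠ l) :
    update α p l (Pi.single a 1) l = p l - α (p a) * p a := by
  rw [update_leader α hp, Finset.sum_eq_single a]
  · simp [Pi.single_eq_of_ne h.symm]
  · intro b _ hb
    rw [Pi.single_eq_of_ne hb, mul_zero]
  · simp [h]

open Classical in
lemma update_single_self (α : ℝ → ℝ) (hp : p ∈ openSimplex ι) {a : ι} (h : a ≠ l) :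
    update α p l (Pi.single a 1) a = p a + α (p a) * p a := by
  have := (pos hp a).ne'
  rw [update_of_ne α _ h, Pi.single_eq_of_ne h.symm]
  simp; field_simp

open Classical in
lemma update_single_leader (α : ℝ → ℝ) {a : ι} (h : a ≠ l) :
    update α p l (Pi.single l 1) a = p a - α (p a) * p a ^ 2 / p l := by
  rw [update_of_ne α _ h, Pi.single_eq_of_ne h]
  simp; ring

open Classical in
lemma update_single_other (α : ℝ → ℝ) {a b : ι} (h : a ≠ l) (hb : b ≠ l) (hab : a ≠ b) :
    update α p l (Pi.single b 1) a = p a := by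
  rw [update_of_ne α _ h, Pi.single_eq_of_ne hab, Pi.single_eq_of_ne hb.symm]
  simp

lemma sum_update (α : ℝ → ℝ) (z : ι → ℝ) : ∑ a, update α p l z a = 1 := by
  classical
  have h : ∀ a ∈ Finset.univ.erase l, update α p l z a = updateOther α p l z a :=
    fun a ha => if_neg (Finset.ne_of_mem_erase ha)
  rw [← Finset.add_sum_erase _ _ (Finset.mem_univ l), Finset.sum_congr rfl h, update,
    if_pos rfl, Finset.filter_ne']
  ring

lemma spread_nonneg (hβ : 0 < β) (hp : p ∈ openSimplex ι) (l : ι) :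
    0 ≤ spread (logRate β) p l :=
  Finset.sum_nonneg fun b _ =>
    mul_nonneg (logRate_pos hβ (pos hp b) (le_one hp b)).le (sq_nonneg _)

lemma spread_le (hβ : β ≤ 1) (hp : p ∈ openSimplex ι) (hl : l ∈ leaders p) :
    spread (logRate β) p l ≤ p l := by
  classical
  have hb : ∀ b, logRate β (p b) * p b ^ 2 ≤ p l * p b := fun b => by
    have h0 := pos hp b
    calc logRate β (p b) * p b ^ 2 ≤ 1 * p b ^ 2 := by
          gcongr; exact logRate_le_one hβ h0 (le_one hp b)
      _ = p b * p b := by ring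
      _ ≤ p l * p b := by gcongr; exact mem_leaders.1 hl b
  calc spread (logRate β) p l ≤ ∑ b ∈ Finset.univ.erase l, p l * p b :=
        Finset.sum_le_sum fun b _ => hb b
    _ = p l * (1 - p l) := by rw [← Finset.mul_sum, sum_erase hp]
    _ ≤ p l * 1 := by
        have := pos hp l
        gcongr; linarith
    _ = p l := mul_one _

/-- Each term of `spread` is at least cubic in the probability of the arm. -/
lemma mul_cube_le_spread (hβ : 0 < β) (hp : p ∈ openSimplex ι) {a : ι} (ha : a ≠ l) :
    β * p a ^ 3 ≤ spread (logRate β) p l := by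
  classical
  have h1 : logRate β (p a) * p a ^ 2 ≤ spread (logRate β) p l :=
    Finset.single_le_sum (f := fun b => logRate β (p b) * p b ^ 2)
      (fun b _ => mul_nonneg (logRate_pos hβ (pos hp b) (le_one hp b)).le (sq_nonneg _))
      (Finset.mem_erase.2 ⟨ha, Finset.mem_univ a⟩)
  refine le_trans ?_ h1
  calc β * p a ^ 3 = β * p a * p a ^ 2 := by ring
    _ ≤ _ := by gcongr; exact mul_le_logRate hβ (pos hp a) (le_one hp a)

open Classical in
/-- The open simplex is invariant: an arm that loses probability loses at most the fraction
`2 / 3` of it. -/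
lemma update_mem (hβ0 : 0 < β) (hβ : β ≤ 1) (hp : p ∈ openSimplex ι) (hl : l ∈ leaders p)
    (a : ι) : update (logRate β) p l (Pi.single a 1) ∈ openSimplex ι := by
  refine ⟨fun b => ?_, sum_update _ _⟩
  have hb := pos hp b
  have hl0 := pos hp l
  have hrate : ∀ {b}, b ≠ l → 0 < logRate β (p b) ∧ logRate β (p b) ≤ 2 / 3 := fun h =>
    ⟨logRate_pos hβ0 (pos hp _) (le_one hp _),
      logRate_le_two_thirds hβ (pos hp _) (le_half hp hl h)⟩
  by_cases hbl : b = l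
  · subst hbl
    by_cases hab : a = b
    · subst hab
      rw [update_leader_single_self _ hp]
      have := spread_nonneg hβ0 hp a
      positivity
    · rw [update_leader_single_of_ne _ hp hab]
      have h1 := mem_leaders.1 hl a
      have h2 := pos hp a
      have h3 := (hrate hab).2
      nlinarith
  · by_cases hab : a = b
    · subst hab
      rw [update_single_self _ hp hbl]
      have := (hrate hbl).1
      positivity
    · by_cases hal : a = l
      · subst hal
        rw [update_single_leader _ hbl]
        have h1 := mem_leaders.1 hl b
        have h3 := hrate hbl
        have h4 : logRate β (p b) * p b ^ 2 / p a ≤ 2 / 3 * p b := by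
          rw [div_le_iff₀ hl0]
          have : logRate β (p b) * p b ≤ 2 / 3 * p a :=
            mul_le_mul h3.2 h1 hb.le (by norm_num)
          nlinarith
        linarith
      · rw [update_single_other _ hbl hal (Ne.symm hab)]
        exact hb

end Step

/-! ### Drift of the probability of the best arm -/

section Drift

variable {ι : Type*} [Fintype ι] {β Δ : ℝ} {p r : ι → ℝ} {l s : ι}

open openSimplex

open Classical in
/-- The mean of `φ` after one step of the algorithm from `p`. -/
def step (r : ι → ℝ) (α : ℝ → ℝ) (φ : (ι → ℝ) → ℝ) (p : ι → ℝ) : ℝ :=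
  ∑ a, ∑ l, p a * leaderProb p l *
    (r a * φ (update α p l (Pi.single a 1)) + (1 - r a) * φ (update α p l 0))

open Classical in
/-- The expected increment, in one step from `p` with leading arm `l`, of the function `f` of the
probability of arm `s`. -/
def increment (r : ι → ℝ) (α : ℝ → ℝ) (p : ι → ℝ) (l s : ι) (f : ℝ → ℝ) : ℝ :=
  ∑ a, p a * r a * (f (update α p l (Pi.single a 1) s) - f (p s))

lemma step_le [Nonempty ι] (α : ℝ → ℝ) (hp : p ∈ openSimplex ι) (f : ℝ → ℝ) (w : ℝ)
    (h : ∀ l ∈ leaders p, increment r α p l s f ≤ -w) :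
    step r α (fun p => f (p s)) p ≤ f (p s) - w := by
  classical
  have h1 : ∀ l, ∑ a, p a * leaderProb p l *
      (r a * f (update α p l (Pi.single a 1) s) + (1 - r a) * f (update α p l 0 s))
      = leaderProb p l * (increment r α p l s f + f (p s)) := by
    intro l
    have : f (p s) = ∑ a, p a * f (p s) := by rw [← Finset.sum_mul, hp.2, one_mul]
    rw [update_zero α hp]
    conv_rhs => rw [this]
    rw [increment, ← Finset.sum_add_distrib, Finset.mul_sum]
    exact Finset.sum_congr rfl fun a _ => by ring
  rw [step, Finset.sum_comm, Finset.sum_congr rfl fun l _ => h1 l]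
  calc ∑ l, leaderProb p l * (increment r α p l s f + f (p s))
      ≤ ∑ l, leaderProb p l * (f (p s) - w) := by
        refine Finset.sum_le_sum fun l _ => ?_
        by_cases hl : l ∈ leaders p
        · have := h l hl
          have := leaderProb_nonneg p l
          gcongr; linarith
        · simp [leaderProb_of_notMem hl]
    _ = f (p s) - w := by rw [← Finset.sum_mul, sum_leaderProb, one_mul]

open Classical in
lemma increment_self (α : ℝ → ℝ) (hp : p ∈ openSimplex ι) (f : ℝ → ℝ) :
    increment r α p s s f = p s * r s * (f (p s + spread α p s / p s) - f (p s)) +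
      ∑ a ∈ Finset.univ.erase s, p a * r a * (f (p s - α (p a) * p a) - f (p s)) := by
  rw [increment, ← Finset.add_sum_erase _ _ (Finset.mem_univ s),
    update_leader_single_self _ hp]
  congr 1
  refine Finset.sum_congr rfl fun a ha => ?_
  rw [update_leader_single_of_ne _ hp (Finset.ne_of_mem_erase ha)]

lemma increment_of_ne (α : ℝ → ℝ) (hp : p ∈ openSimplex ι) (h : s ≠ l) (f : ℝ → ℝ) :
    increment r α p l s f = p s * r s * (f (p s + α (p s) * p s) - f (p s)) +
      p l * r l * (f (p s - α (p s) * p s ^ 2 / p l) - f (p s)) := by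
  classical
  rw [increment, Fintype.sum_eq_add s l h, update_single_self _ hp h, update_single_leader _ h]
  rintro a ⟨has, hal⟩
  rw [update_single_other _ h hal (Ne.symm has)]
  simp

lemma increment_neg (α : ℝ → ℝ) (f : ℝ → ℝ) :
    increment r α p l s (fun x => -f x) = -increment r α p l s f := by
  rw [increment, increment, ← Finset.sum_neg_distrib]
  exact Finset.sum_congr rfl fun a _ => by ring

/-- While the best arm leads, its probability increases in mean by at least `Δ * spread`. -/
lemma le_increment_id_self (hβ0 : 0 < β) (hp : p ∈ openSimplex ι)
    (hΔ : ∀ a, a ≠ s → Δ ≤ r s - r a) :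
    Δ * spread (logRate β) p s ≤ increment r (logRate β) p s s id := by
  classical
  have h0 := (pos hp s).ne'
  rw [increment_self _ hp]
  have : p s * r s * (id (p s + spread (logRate β) p s / p s) - id (p s))
      = r s * spread (logRate β) p s := by
    simp only [id]; field_simp; ring
  rw [this, spread, Finset.mul_sum, Finset.mul_sum, ← Finset.sum_add_distrib]
  refine Finset.sum_le_sum fun a ha => ?_
  have h1 := hΔ a (Finset.ne_of_mem_erase ha)
  have h2 := logRate_pos hβ0 (pos hp a) (le_one hp a)
  calc Δ * (logRate β (p a) * p a ^ 2) ≤ (r s - r a) * (logRate β (p a) * p a ^ 2) := by gcongr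
    _ = _ := by simp only [id]; ring

lemma le_increment_id_of_ne (hβ0 : 0 < β) (hp : p ∈ openSimplex ι) (h : s ≠ l)
    (hΔ : ∀ a, a ≠ s → Δ ≤ r s - r a) :
    Δ * (logRate β (p s) * p s ^ 2) ≤ increment r (logRate β) p l s id := by
  have h0 := (pos hp l).ne'
  rw [increment_of_ne _ hp h]
  have h1 := hΔ l h.symm
  have h2 := logRate_pos hβ0 (pos hp s) (le_one hp s)
  calc Δ * (logRate β (p s) * p s ^ 2) ≤ (r s - r l) * (logRate β (p s) * p s ^ 2) := by gcongr
    _ = _ := by simp only [id]; field_simp; ring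

/-- Second-order bound for `x ↦ 1 / x ^ 2`, valid for relative decrements of at most `2 / 3`. -/
lemma inv_sq_sub_le {x y : ℝ} (hx : 0 < x) (hy : x / 3 ≤ y) :
    (y ^ 2)⁻¹ - (x ^ 2)⁻¹ ≤ -2 / x ^ 3 * (y - x) + 15 / x ^ 4 * (y - x) ^ 2 := by
  have hy0 : 0 < y := by linarith
  have key : (-2 / x ^ 3 * (y - x) + 15 / x ^ 4 * (y - x) ^ 2) - ((y ^ 2)⁻¹ - (x ^ 2)⁻¹)
      = (y - x) ^ 2 * ((3 * y - x) * (5 * y + x)) / (x ^ 4 * y ^ 2) := by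
    field_simp; ring
  have : 0 ≤ (y - x) ^ 2 * ((3 * y - x) * (5 * y + x)) / (x ^ 4 * y ^ 2) := by
    apply div_nonneg _ (by positivity)
    apply mul_nonneg (sq_nonneg _)
    apply mul_nonneg <;> linarith
  linarith

lemma increment_inv_sq_le (α : ℝ → ℝ) (hp : p ∈ openSimplex ι) (hr : ∀ a, 0 ≤ r a)
    (h : ∀ a, p s / 3 ≤ update α p l (open Classical in Pi.single a 1) s) :
    increment r α p l s (fun x => (x ^ 2)⁻¹) ≤
      -2 / p s ^ 3 * increment r α p l s id +
        15 / p s ^ 4 * increment r α p l s (fun x => (x - p s) ^ 2) := by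
  classical
  simp only [increment, Finset.mul_sum, ← Finset.sum_add_distrib]
  refine Finset.sum_le_sum fun a _ => ?_
  have h1 := inv_sq_sub_le (pos hp s) (h a)
  have h2 : 0 ≤ p a * r a := mul_nonneg (pos hp a).le (hr a)
  refine (mul_le_mul_of_nonneg_left h1 h2).trans (le_of_eq ?_)
  simp only [id]; ring

lemma increment_sq_self_le (hβ0 : 0 < β) (hβ : β ≤ 1) (hp : p ∈ openSimplex ι)
    (hr1 : ∀ a, r a ≤ 1) (hs : s ∈ leaders p) :
    increment r (logRate β) p s s (fun x => (x - p s) ^ 2) ≤ 2 * spread (logRate β) p s := by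
  classical
  have h0 := pos hp s
  have hS := spread_nonneg hβ0 hp s
  have hS' := spread_le hβ hp hs
  rw [increment_self _ hp, two_mul]
  apply add_le_add
  · calc p s * r s * ((p s + spread (logRate β) p s / p s - p s) ^ 2 - (p s - p s) ^ 2)
        = r s * (spread (logRate β) p s * (spread (logRate β) p s / p s)) := by
          field_simp; ring
      _ ≤ 1 * (spread (logRate β) p s * 1) := by
          gcongr
          · exact hr1 s
          · exact (div_le_one h0).2 hS'
      _ = _ := by ring
  · refine Finset.sum_le_sum fun a ha => ?_
    have h1 := logRate_pos hβ0 (pos hp a) (le_one hp a)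
    have h2 := logRate_le_one hβ (pos hp a) (le_one hp a)
    have h3 := pos hp a
    calc p a * r a * ((p s - logRate β (p a) * p a - p s) ^ 2 - (p s - p s) ^ 2)
        = r a * p a * logRate β (p a) * (logRate β (p a) * p a ^ 2) := by ring
      _ ≤ 1 * 1 * 1 * (logRate β (p a) * p a ^ 2) := by
          gcongr
          · exact hr1 a
          · exact le_one hp a
      _ = _ := by ring

lemma increment_sq_of_ne_le (hp : p ∈ openSimplex ι)
    (hr0 : ∀ a, 0 ≤ r a) (hr1 : ∀ a, r a ≤ 1) (hl : l ∈ leaders p) (h : s ≠ l) :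
    increment r (logRate β) p l s (fun x => (x - p s) ^ 2) ≤
      2 * (logRate β (p s) ^ 2 * p s ^ 3) := by
  have h0 := pos hp s
  have hl0 := pos hp l
  have h1 := mem_leaders.1 hl s
  have hr2 := hr0 s
  rw [increment_of_ne _ hp h, two_mul]
  apply add_le_add
  · calc p s * r s * ((p s + logRate β (p s) * p s - p s) ^ 2 - (p s - p s) ^ 2)
        = r s * (logRate β (p s) ^ 2 * p s ^ 3) := by ring
      _ ≤ 1 * (logRate β (p s) ^ 2 * p s ^ 3) := by gcongr; exact hr1 s
      _ = _ := by ring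
  · calc p l * r l * ((p s - logRate β (p s) * p s ^ 2 / p l - p s) ^ 2 - (p s - p s) ^ 2)
        = r l * (p s / p l) * (logRate β (p s) ^ 2 * p s ^ 3) := by field_simp; ring
      _ ≤ 1 * 1 * (logRate β (p s) ^ 2 * p s ^ 3) := by
          gcongr
          · exact hr1 l
          · exact (div_le_one hl0).2 h1
      _ = _ := by ring

lemma third_le_update (hβ0 : 0 < β) (hβ : β ≤ 1) (hp : p ∈ openSimplex ι)
    (hl : l ∈ leaders p) (a : ι) :
    p s / 3 ≤ update (logRate β) p l (open Classical in Pi.single a 1) s := by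
  classical
  have h0 := pos hp s
  have hl0 := pos hp l
  have hrate : ∀ {b}, b ≠ l → 0 < logRate β (p b) ∧ logRate β (p b) ≤ 2 / 3 := fun h =>
    ⟨logRate_pos hβ0 (pos hp _) (le_one hp _),
      logRate_le_two_thirds hβ (pos hp _) (le_half hp hl h)⟩
  by_cases hsl : s = l
  · subst hsl
    by_cases has : a = s
    · subst has
      rw [update_leader_single_self _ hp]
      have : 0 ≤ spread (logRate β) p a / p a := div_nonneg (spread_nonneg hβ0 hp a) h0.le
      linarith
    · rw [update_leader_single_of_ne _ hp has]
      have : logRate β (p a) * p a ≤ 2 / 3 * p s :=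
        mul_le_mul (hrate has).2 (mem_leaders.1 hl a) (pos hp a).le (by norm_num)
      linarith
  · by_cases has : s = a
    · subst has
      rw [update_single_self _ hp hsl]
      have := mul_pos (hrate hsl).1 h0
      linarith
    · by_cases hal : a = l
      · subst hal
        rw [update_single_leader _ hsl]
        have : logRate β (p s) * p s ^ 2 / p a ≤ 2 / 3 * p s := by
          rw [div_le_iff₀ hl0]
          have : logRate β (p s) * p s ≤ 2 / 3 * p a :=
            mul_le_mul (hrate hsl).2 (mem_leaders.1 hl s) h0.le (by norm_num)
          nlinarith
        linarith
      · rw [update_single_other _ hsl hal has]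
        linarith

/-- If arm `s` has probability at most `1 / 2`, then another arm has probability at least
`1 / (2 N)`, so the spread around `s` is bounded below. -/
lemma le_spread_of_le_half [Nontrivial ι] (hβ0 : 0 < β) (hp : p ∈ openSimplex ι)
    (h : p s ≤ 1 / 2) :
    β * (1 / (2 * Fintype.card ι)) ^ 3 ≤ spread (logRate β) p s := by
  classical
  have hN : (0 : ℝ) < Fintype.card ι := by exact_mod_cast Fintype.card_pos
  obtain ⟨b, hb, hb'⟩ : ∃ b ∈ Finset.univ.erase s, 1 / (2 * (Fintype.card ι : ℝ)) ≤ p b := by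
    apply Finset.exists_le_of_sum_le
    · obtain ⟨b, hb⟩ := exists_ne s
      exact ⟨b, by simp [hb]⟩
    · rw [sum_erase hp, Finset.sum_const, nsmul_eq_mul]
      have : ((Finset.univ.erase s).card : ℝ) ≤ Fintype.card ι := by
        exact_mod_cast Finset.card_le_univ _
      calc ((Finset.univ.erase s).card : ℝ) * (1 / (2 * (Fintype.card ι : ℝ)))
          ≤ Fintype.card ι * (1 / (2 * (Fintype.card ι : ℝ))) := by gcongr
        _ = 1 / 2 := by field_simp
        _ ≤ 1 - p s := by linarith
  refine le_trans ?_ (mul_cube_le_spread hβ0 hp (Finset.ne_of_mem_erase hb))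
  gcongr

lemma one_div_card_le (hp : p ∈ openSimplex ι) (hl : l ∈ leaders p) :
    1 / (Fintype.card ι : ℝ) ≤ p l := by
  have hN : (0 : ℝ) < Fintype.card ι := by
    have : Nonempty ι := ⟨l⟩
    exact_mod_cast Fintype.card_pos
  rw [div_le_iff₀ hN, ← hp.2]
  calc ∑ a, p a ≤ ∑ _a : ι, p l := Finset.sum_le_sum fun a _ => mem_leaders.1 hl a
    _ = p l * Fintype.card ι := by simp [mul_comm]

/-- Lyapunov function: for the best arm `s`, `1 / p s ^ 2` compensated by a large multiple of
`1 - p s` decreases in mean, and does so at a positive rate while `p s ≤ 1 / 2`. Near `p s = 0`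
the second-order term of `1 / p s ^ 2` is beaten by its drift because the rate is small there;
elsewhere it is at most a multiple of the drift of `p s`. -/
lemma exists_lyapunov [Nontrivial ι] (hβ0 : 0 < β) (hβ : β ≤ 1) (hr0 : ∀ a, 0 ≤ r a)
    (hr1 : ∀ a, r a ≤ 1) (hΔ0 : 0 < Δ) (hΔ : ∀ a, a ≠ s → Δ ≤ r s - r a) :
    ∃ K c : ℝ, 0 ≤ K ∧ 0 < c ∧ ∀ p ∈ openSimplex ι,
      step r (logRate β) (fun p => (p s ^ 2)⁻¹ + K * (1 - p s)) p
        ≤ ((p s ^ 2)⁻¹ + K * (1 - p s)) - (if p s ≤ 1 / 2 then c else 0) := by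
  obtain ⟨K₁, hK₁, hK₁'⟩ := exists_logRate_le hβ (δ := Δ / 30) (by positivity)
  set N : ℝ := (Fintype.card ι : ℝ) with hN_def
  have hN : 0 < N := by rw [hN_def]; exact_mod_cast Fintype.card_pos
  -- `K * Δ` absorbs the second-order terms: `30 * N ^ 4` while the best arm leads, `30 * K₁`
  -- while it does not; the summand `1` is the remaining decrease
  set K : ℝ := (30 * K₁ + 30 * N ^ 4 + 1) / Δ with hK_def
  have hK : 0 ≤ K := by positivity
  have hKΔ : K * Δ = 30 * K₁ + 30 * N ^ 4 + 1 := by rw [hK_def]; field_simp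
  set c : ℝ := min (β * Δ) (β * (1 / (2 * N)) ^ 3) with hc_def
  have hc : 0 < c := by rw [hc_def]; positivity
  refine ⟨K, c, hK, hc, fun p hp => ?_⟩
  refine step_le _ hp (fun x => (x ^ 2)⁻¹ + K * (1 - x)) _ fun l hl => ?_
  have hx := pos hp s
  have hx1 := le_one hp s
  have hsplit : increment r (logRate β) p l s (fun x => (x ^ 2)⁻¹ + K * (1 - x))
      = increment r (logRate β) p l s (fun x => (x ^ 2)⁻¹)
        - K * increment r (logRate β) p l s id := by
    rw [increment, increment, increment, Finset.mul_sum, ← Finset.sum_sub_distrib]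
    exact Finset.sum_congr rfl fun a _ => by simp only [id]; ring
  have hT := increment_inv_sq_le (logRate β) hp hr0 (third_le_update (s := s) hβ0 hβ hp hl)
  rw [hsplit]
  set D := increment r (logRate β) p l s id with hD_def
  set S := increment r (logRate β) p l s (fun x => (x - p s) ^ 2) with hS_def
  set x := p s with hx_def
  by_cases hsl : s = l
  · -- The best arm leads: its probability is at least `1 / N`.
    subst hsl
    have hD := le_increment_id_self hβ0 hp hΔ
    rw [← hD_def] at hD
    have hS := increment_sq_self_le hβ0 hβ hp hr1 hl
    rw [← hx_def, ← hS_def] at hS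
    have hσ := spread_nonneg hβ0 hp s
    set σ := spread (logRate β) p s with hσ_def
    have hD0 : 0 ≤ D := le_trans (by positivity) hD
    have h1 : -2 / x ^ 3 * D ≤ 0 := by
      rw [neg_div, neg_mul]
      have : 0 ≤ 2 / x ^ 3 * D := by positivity
      linarith
    have h2 : 15 / x ^ 4 * S ≤ 30 * N ^ 4 * σ := by
      have hxN : x⁻¹ ≤ N := by
        rw [inv_le_comm₀ hx hN, ← one_div]; exact one_div_card_le hp hl
      calc 15 / x ^ 4 * S ≤ 15 / x ^ 4 * (2 * σ) := by gcongr
        _ = 30 * x⁻¹ ^ 4 * σ := by field_simp; ring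
        _ ≤ _ := by gcongr
    have h3 : K * (Δ * σ) ≤ K * D := by gcongr
    have h4 : K * (Δ * σ) = (30 * K₁ + 30 * N ^ 4 + 1) * σ := by rw [← hKΔ]; ring
    have h5 : 0 ≤ K₁ * σ := by positivity
    have h6 : (if x ≤ 1 / 2 then c else 0) ≤ σ := by
      split_ifs with hh
      · exact (min_le_right _ _).trans (le_spread_of_le_half hβ0 hp hh)
      · exact hσ
    linarith
  · -- Another arm leads: the increment is a multiple of `a / x`, which is at least `β`.
    have hD := le_increment_id_of_ne hβ0 hp hsl hΔ
    rw [← hD_def, ← hx_def] at hD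
    have hS := increment_sq_of_ne_le (β := β) hp hr0 hr1 hl hsl
    rw [← hx_def, ← hS_def] at hS
    have hα := logRate_pos hβ0 hx hx1
    have hα1 := mul_le_logRate hβ0 hx hx1
    have hα2 := hK₁' x hx hx1
    set a := logRate β x with ha_def
    have h1 : (2 / x ^ 3 + K) * (Δ * (a * x ^ 2)) ≤ (2 / x ^ 3 + K) * D := by gcongr
    have h2 : 15 / x ^ 4 * S ≤ 15 / x ^ 4 * (2 * (a ^ 2 * x ^ 3)) := by gcongr
    have h3 : 15 / x ^ 4 * (2 * (a ^ 2 * x ^ 3)) - (2 / x ^ 3 + K) * (Δ * (a * x ^ 2))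
        = a / x * (30 * a - 2 * Δ - K * Δ * x ^ 3) := by field_simp; ring
    have h4 : 30 * a - 2 * Δ - K * Δ * x ^ 3 ≤ -Δ := by
      rw [hKΔ]
      have : 0 ≤ N ^ 4 * x ^ 3 := by positivity
      have : 0 ≤ x ^ 3 := by positivity
      nlinarith
    have h5 : β ≤ a / x := (le_div_iff₀ hx).2 hα1
    have h6 : a / x * (30 * a - 2 * Δ - K * Δ * x ^ 3) ≤ -(β * Δ) := by
      calc a / x * (30 * a - 2 * Δ - K * Δ * x ^ 3) ≤ a / x * (-Δ) := by gcongr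
        _ ≤ β * (-Δ) := mul_le_mul_of_nonpos_right h5 (by linarith)
        _ = _ := by ring
    have h7 : (if x ≤ 1 / 2 then c else 0) ≤ β * Δ := by
      split_ifs with hh
      · exact min_le_left _ _
      · positivity
    have h8 : -2 / x ^ 3 * D - K * D = -((2 / x ^ 3 + K) * D) := by ring
    linarith

/-- A lower bound for the expected decrease of `1 - p s` in one step, where `s` is the best arm
and `Δ` the gap; it only counts the steps from vectors with `p s > 1 / 2`. -/
def loss (Δ β : ℝ) (s : ι) (p : ι → ℝ) : ℝ :=
  if 1 / 2 < p s then Δ * spread (logRate β) p s else 0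

lemma loss_nonneg (hβ0 : 0 < β) (hΔ0 : 0 < Δ) (s : ι) (hp : p ∈ openSimplex ι) :
    0 ≤ loss Δ β s p := by
  unfold loss
  have := spread_nonneg hβ0 hp s
  split_ifs <;> positivity

/-- The probability `1 - p s` of missing the best arm decreases in mean. -/
lemma step_one_sub_le [Nontrivial ι] (hβ0 : 0 < β) (hp : p ∈ openSimplex ι) (hΔ0 : 0 < Δ)
    (hΔ : ∀ a, a ≠ s → Δ ≤ r s - r a) :
    step r (logRate β) (fun p => 1 - p s) p
      ≤ (1 - p s) - loss Δ β s p := by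
  refine step_le _ hp (fun x => 1 - x) _ fun l hl => ?_
  have h1 : increment r (logRate β) p l s (fun x => 1 - x)
      = -increment r (logRate β) p l s id := by
    rw [← increment_neg]
    exact Finset.sum_congr rfl fun a _ => by simp only [id]; ring
  rw [h1, neg_le_neg_iff, loss]
  split_ifs with h
  · rw [leaders_eq hp h hl]
    exact le_increment_id_self hβ0 hp hΔ
  · by_cases hsl : s = l
    · subst hsl
      have := spread_nonneg hβ0 hp s
      exact le_trans (by positivity) (le_increment_id_self hβ0 hp hΔ)
    · have := logRate_pos hβ0 (pos hp s) (le_one hp s)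
      exact le_trans (by positivity) (le_increment_id_of_ne hβ0 hp hsl hΔ)

end Drift

/-! ### Measurability -/

section Data

variable {ι Ω : Type*}

/-- The observed data of an arm are a function of the arm played and of its reward. -/
lemma played_mul_eq (R : ℕ → ι → Ω → ℝ) (A : ℕ → Ω → ι) (t : ℕ) (a : ι) (ω : Ω) :
    played A t a ω * R t a ω = played A t a ω * R t (A t ω) ω := by
  unfold played
  split_ifs with h
  · rw [h]
  · simp

variable [MeasurableSpace ι]

lemma history_mono (R : ℕ → ι → Ω → ℝ) (A L : ℕ → Ω → ι) {t u : ℕ} (h : t ≤ u) : history R A L t ≤ history R A L u :=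
  iSup_le fun s => le_iSup_of_le (Fin.castLE h s) le_rfl

lemma measurable_played [MeasurableSingletonClass ι] {m : MeasurableSpace Ω}
    {A : Ω → ι} (hA : Measurable A) (a : ι) :
    Measurable (played (fun _ => A) 0 a) := by
  classical
  exact Measurable.ite (hA (measurableSet_singleton a)) measurable_const measurable_const

end Data

section Measurability

variable {ι Ω : Type*} [Fintype ι] {α : ℝ → ℝ}

lemma measurable_logRate (β : ℝ) : Measurable (logRate β) :=
  measurable_const.div (measurable_const.sub Real.measurable_log)

lemma measurableSet_mem_leaders (l : ι) : MeasurableSet {p : ι → ℝ | l ∈ leaders p} := by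
  simp only [mem_leaders, Set.ofPred_forall]
  exact MeasurableSet.iInter fun b =>
    measurableSet_le (measurable_pi_apply b) (measurable_pi_apply l)

lemma measurable_leaderProb (l : ι) : Measurable fun p : ι → ℝ => leaderProb p l := by
  classical
  have hcard : ∀ p : ι → ℝ, ((leaders p).card : ℝ) = ∑ b, if b ∈ leaders p then 1 else 0 := by
    intro p; simp
  simp only [leaderProb, hcard]
  refine Measurable.ite (measurableSet_mem_leaders l) (Measurable.inv ?_) measurable_const
  exact Finset.measurable_sum _ fun b _ =>
    Measurable.ite (measurableSet_mem_leaders b) measurable_const measurable_const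

lemma measurable_spread (hα : Measurable α) (s : ι) :
    Measurable fun p : ι → ℝ => spread α p s := by
  unfold spread
  fun_prop

lemma measurable_loss (Δ β : ℝ) (s : ι) : Measurable (loss Δ β s) :=
  Measurable.ite (measurableSet_lt measurable_const (measurable_pi_apply s))
    ((measurable_spread (measurable_logRate β) s).const_mul Δ) measurable_const

lemma measurable_update (hα : Measurable α) (l : ι) :
    Measurable fun x : (ι → ℝ) × (ι → ℝ) => update α x.1 l x.2 := by
  refine measurable_pi_lambda _ fun a => ?_
  have h : ∀ b, Measurable fun x : (ι → ℝ) × (ι → ℝ) => updateOther α x.1 l x.2 b := by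
    intro b; unfold updateOther; fun_prop
  unfold update
  split_ifs
  · exact measurable_const.sub (Finset.measurable_sum _ fun b _ => h b)
  · exact h a

lemma measurable_update_left (hα : Measurable α) (l : ι) (z : ι → ℝ) :
    Measurable fun p : ι → ℝ => update α p l z :=
  (measurable_update hα l).comp (measurable_id.prodMk measurable_const)

lemma measurableSet_openSimplex : MeasurableSet (openSimplex ι) := by
  refine MeasurableSet.inter (s₁ := {p : ι → ℝ | ∀ a, 0 < p a})
    (s₂ := {p : ι → ℝ | ∑ a, p a = 1}) ?_ ?_
  · rw [Set.ofPred_forall]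
    exact MeasurableSet.iInter fun a => measurableSet_lt measurable_const (measurable_pi_apply a)
  · exact measurableSet_eq_fun (by fun_prop) measurable_const

variable [MeasurableSpace ι] [MeasurableSingletonClass ι] {m : MeasurableSpace Ω}

variable (R : ℕ → ι → Ω → ℝ) (A L : ℕ → Ω → ι)

lemma measurable_reward_comp {R : ι → Ω → ℝ} {A : Ω → ι} (hR : ∀ a, Measurable (R a))
    (hA : Measurable A) : Measurable fun ω => R (A ω) ω :=
  (measurable_from_prod_countable_right (f := fun x : ι × Ω => R x.1 x.2) hR).comp
    (hA.prodMk measurable_id)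

lemma measurable_prob_history (hα : Measurable α) (p₀ : ι → ℝ) (t : ℕ) :
    Measurable[history R A L t] (prob α p₀ R A L t) := by
  induction t with
  | zero => exact measurable_const
  | succ t ih =>
    set m' := history R A L (t + 1) with hm'
    have hle : MeasurableSpace.comap (A t) inferInstance ⊔
        MeasurableSpace.comap (L t) inferInstance ⊔
        MeasurableSpace.comap (fun ω => R t (A t ω) ω) inferInstance ≤ m' :=
      le_iSup_of_le (Fin.last t) le_rfl
    have hA : Measurable[m'] (A t) :=
      measurable_iff_comap_le.2 ((le_sup_left.trans le_sup_left).trans hle)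
    have hL : Measurable[m'] (L t) :=
      measurable_iff_comap_le.2 ((le_sup_right.trans le_sup_left).trans hle)
    have hR : Measurable[m'] (fun ω => R t (A t ω) ω) :=
      measurable_iff_comap_le.2 (le_sup_right.trans hle)
    have hp : Measurable[m'] (prob α p₀ R A L t) :=
      ih.mono (history_mono R A L t.le_succ) le_rfl
    have hz : Measurable[m'] fun ω a => played A t a ω * R t a ω := by
      simp only [played_mul_eq]
      exact measurable_pi_lambda _ fun a => (measurable_played hA a).mul hR
    have hU : Measurable fun x : ι × ((ι → ℝ) × (ι → ℝ)) => update α x.2.1 x.1 x.2.2 :=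
      measurable_from_prod_countable_right fun l => measurable_update hα l
    exact hU.comp (hL.prodMk (hp.prodMk hz))

end Measurability

/-! ### The conditional law of one step -/

section Transition

variable {ι : Type*} [Fintype ι] {α : ℝ → ℝ} {r : ι → ℝ}

open Classical in
lemma lintegral_transition (r : ι → ℝ) (α : ℝ → ℝ) (p : ι → ℝ) {Φ : (ι → ℝ) → ENNReal}
    (hΦ : Measurable Φ) :
    ∫⁻ x, Φ x ∂transition r α p = ∑ a, ∑ l, ENNReal.ofReal (p a * leaderProb p l) *
      (ENNReal.ofReal (r a) * Φ (update α p l (Pi.single a 1)) +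
        ENNReal.ofReal (1 - r a) * Φ (update α p l 0)) := by
  simp only [transition, lintegral_finsetSum_measure, lintegral_smul_measure,
    lintegral_add_measure, lintegral_dirac' _ hΦ, smul_eq_mul]

lemma transition_apply (r : ι → ℝ) (α : ℝ → ℝ) (p : ι → ℝ) {B : Set (ι → ℝ)}
    (hB : MeasurableSet B) :
    transition r α p B = ∫⁻ x, B.indicator 1 x ∂transition r α p :=
  (lintegral_indicator_one hB).symm

lemma measurable_transition (hα : Measurable α) (r : ι → ℝ) : Measurable (transition r α) := by
  refine Measure.measurable_of_measurable_coe _ fun B hB => ?_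
  have hΦ : Measurable (B.indicator (1 : (ι → ℝ) → ENNReal)) := measurable_one.indicator hB
  simp only [transition_apply r α _ hB, lintegral_transition r α _ hΦ]
  refine Finset.measurable_sum _ fun a _ => Finset.measurable_sum _ fun l _ => ?_
  refine (((measurable_pi_apply a).mul (measurable_leaderProb l)).ennreal_ofReal).mul ?_
  exact ((hΦ.comp (measurable_update_left hα l _)).const_mul _).add
    ((hΦ.comp (measurable_update_left hα l _)).const_mul _)

variable {β : ℝ} {p : ι → ℝ}

/-- On the simplex, the integral against the transition law is the finite sum `step`; only
leading arms have positive weight, and these lead back into the simplex. -/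
lemma lintegral_ofReal_transition (hβ0 : 0 < β) (hβ : β ≤ 1) (hr : ∀ a, r a ∈ Set.Icc (0 : ℝ) 1)
    (hp : p ∈ openSimplex ι) {V : (ι → ℝ) → ℝ} (hV : Measurable V)
    (hV0 : ∀ x ∈ openSimplex ι, 0 ≤ V x) :
    0 ≤ step r (logRate β) V p ∧
    ∫⁻ x, ENNReal.ofReal (V x) ∂transition r (logRate β) p
      = ENNReal.ofReal (step r (logRate β) V p) := by
  classical
  have hw : ∀ a l, 0 ≤ p a * leaderProb p l := fun a l =>
    mul_nonneg (hp.1 a).le (leaderProb_nonneg p l)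
  have hr0 : ∀ a, 0 ≤ 1 - r a := fun a => sub_nonneg.2 (hr a).2
  have key : ∀ a l, 0 ≤ p a * leaderProb p l *
      (r a * V (update (logRate β) p l (Pi.single a 1)) +
        (1 - r a) * V (update (logRate β) p l 0)) ∧
      ENNReal.ofReal (p a * leaderProb p l) *
      (ENNReal.ofReal (r a) * ENNReal.ofReal (V (update (logRate β) p l (Pi.single a 1))) +
        ENNReal.ofReal (1 - r a) * ENNReal.ofReal (V (update (logRate β) p l 0)))
      = ENNReal.ofReal (p a * leaderProb p l *
      (r a * V (update (logRate β) p l (Pi.single a 1)) +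
        (1 - r a) * V (update (logRate β) p l 0))) := by
    intro a l
    by_cases hl : l ∈ leaders p
    · have h1 := mul_nonneg (hr a).1 (hV0 _ (update_mem hβ0 hβ hp hl a))
      have h2 : 0 ≤ (1 - r a) * V (update (logRate β) p l 0) := by
        rw [update_zero _ hp]; exact mul_nonneg (hr0 a) (hV0 p hp)
      refine ⟨mul_nonneg (hw a l) (add_nonneg h1 h2), ?_⟩
      rw [ENNReal.ofReal_mul (hw a l), ENNReal.ofReal_add h1 h2, ENNReal.ofReal_mul (hr a).1,
        ENNReal.ofReal_mul (hr0 a)]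
    · simp [leaderProb_of_notMem hl]
  constructor
  · exact Finset.sum_nonneg fun a _ => Finset.sum_nonneg fun l _ => (key a l).1
  · rw [lintegral_transition r _ p hV.ennreal_ofReal, step,
      ENNReal.ofReal_sum_of_nonneg fun a _ => Finset.sum_nonneg fun l _ => (key a l).1]
    refine Finset.sum_congr rfl fun a _ => ?_
    rw [ENNReal.ofReal_sum_of_nonneg fun l _ => (key a l).1]
    exact Finset.sum_congr rfl fun l _ => (key a l).2

lemma step_one [Nonempty ι] (r : ι → ℝ) (α : ℝ → ℝ) (hp : p ∈ openSimplex ι) :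
    step r α (fun _ => 1) p = 1 := by
  simp only [step, mul_one, add_sub_cancel, ← Finset.mul_sum, sum_leaderProb]
  exact hp.2

lemma isProbabilityMeasure_transition [Nonempty ι] (hβ0 : 0 < β) (hβ : β ≤ 1)
    (hr : ∀ a, r a ∈ Set.Icc (0 : ℝ) 1) (hp : p ∈ openSimplex ι) :
    IsProbabilityMeasure (transition r (logRate β) p) := by
  constructor
  have h := (lintegral_ofReal_transition hβ0 hβ hr hp (V := fun _ => 1) measurable_const
    fun _ _ => zero_le_one).2
  rw [step_one _ _ hp] at h
  simpa using h

lemma transition_compl_openSimplex (hβ0 : 0 < β) (hβ : β ≤ 1)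
    (hp : p ∈ openSimplex ι) :
    transition r (logRate β) p (openSimplex ι)ᶜ = 0 := by
  classical
  rw [transition_apply r _ p measurableSet_openSimplex.compl,
    lintegral_transition r _ p (measurable_one.indicator measurableSet_openSimplex.compl)]
  refine Finset.sum_eq_zero fun a _ => Finset.sum_eq_zero fun l _ => ?_
  by_cases hl : l ∈ leaders p
  · rw [update_zero _ hp, Set.indicator_of_notMem (a := p) (not_not_intro hp),
      Set.indicator_of_notMem (not_not_intro (update_mem hβ0 hβ hp hl a))]
    simp
  · simp [leaderProb_of_notMem hl]

end Transition

lemma lintegral_sum_sum_add {κ Ω : Type*} [Fintype κ] {mΩ : MeasurableSpace Ω} (μ : Measure Ω)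
    {f g : κ → κ → Ω → ENNReal} (hf : ∀ a l, Measurable (f a l))
    (hg : ∀ a l, Measurable (g a l)) :
    ∫⁻ ω, ∑ a, ∑ l, (f a l ω + g a l ω) ∂μ
      = ∑ a, ∑ l, (∫⁻ ω, f a l ω ∂μ + ∫⁻ ω, g a l ω ∂μ) := by
  have h : ∀ a l, Measurable fun ω => f a l ω + g a l ω := fun a l => (hf a l).add (hg a l)
  rw [lintegral_finsetSum _ fun a _ => Finset.measurable_sum _ fun l _ => h a l]
  refine Finset.sum_congr rfl fun a _ => ?_
  rw [lintegral_finsetSum _ fun l _ => h a l]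
  exact Finset.sum_congr rfl fun l _ => lintegral_add_left (hf a l) _

lemma setLIntegral_inter_of_indep {Ω : Type*} {m₁ m₂ mΩ : MeasurableSpace Ω} {μ : Measure Ω}
    (h₁ : m₁ ≤ mΩ) (h₂ : m₂ ≤ mΩ) (hi : Indep m₁ m₂ μ) {E F : Set Ω}
    (hF : MeasurableSet[m₁] F) (hE : MeasurableSet[m₂] E) {ψ : Ω → ENNReal}
    (hψ : Measurable[m₂] ψ) :
    ∫⁻ ω in E ∩ F, ψ ω ∂μ = μ F * ∫⁻ ω in E, ψ ω ∂μ := by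
  have hf : Measurable[m₁] (F.indicator (fun _ => (1 : ENNReal))) :=
    Measurable.indicator measurable_const hF
  have hg : Measurable[m₂] (E.indicator ψ) := hψ.indicator hE
  have key := lintegral_mul_eq_lintegral_mul_lintegral_of_independent_measurableSpace h₁ h₂
    hi hf hg
  rw [lintegral_indicator_const (h₁ _ hF), one_mul, lintegral_indicator (h₂ _ hE)] at key
  rw [← key, ← lintegral_indicator ((h₂ _ hE).inter (h₁ _ hF))]
  refine lintegral_congr fun ω => ?_
  by_cases h1 : ω ∈ F <;> by_cases h2 : ω ∈ E <;> simp [h1, h2]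

namespace IsSamba

variable {ι Ω : Type*} [Fintype ι] [MeasurableSpace ι]
  {mΩ : MeasurableSpace Ω} {μ : Measure Ω} {r : ι → ℝ} {α : ℝ → ℝ}
  {p₀ : ι → ℝ} {R : ℕ → ι → Ω → ℝ} {A L : ℕ → Ω → ι}




section Rewards

variable [IsProbabilityMeasure μ]

lemma measure_reward_one (hS : IsSamba μ r α p₀ R A L) (t : ℕ) (a : ι) :
    μ {ω | R t a ω = 1} = ENNReal.ofReal (r a) := by
  rw [← hS.rewards.prob_one t a, ofReal_measureReal]

lemma measure_reward_zero (hS : IsSamba μ r α p₀ R A L) (t : ℕ) (a : ι) :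
    μ {ω | R t a ω = 0} = ENNReal.ofReal (1 - r a) := by
  rw [← hS.rewards.prob_zero t a, ofReal_measureReal]

lemma ae_reward (hS : IsSamba μ r α p₀ R A L) :
    ∀ᵐ ω ∂μ, ∀ t a, R t a ω = 0 ∨ R t a ω = 1 := by
  refine ae_all_iff.2 fun t => ae_all_iff.2 fun a => ?_
  have h0 : MeasurableSet {ω | R t a ω = 0} :=
    hS.rewards.measurable t a (measurableSet_singleton 0)
  have h1 : MeasurableSet {ω | R t a ω = 1} :=
    hS.rewards.measurable t a (measurableSet_singleton 1)
  have hd : Disjoint {ω | R t a ω = 0} {ω | R t a ω = 1} := by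
    rw [Set.disjoint_left]
    intro ω hω hω'
    simp only [Set.mem_ofPred_eq] at hω hω'
    rw [hω] at hω'; norm_num at hω'
  have h : μ.real ({ω | R t a ω = 0} ∪ {ω | R t a ω = 1}) = 1 := by
    rw [measureReal_union hd h1, hS.rewards.prob_zero, hS.rewards.prob_one]; ring
  have h' : ∀ᵐ ω ∂μ, ω ∈ {ω | R t a ω = 0} ∪ {ω | R t a ω = 1} := by
    rw [measureReal_def, ENNReal.toReal_eq_one_iff] at h
    exact (mem_ae_iff_prob_eq_one (h0.union h1)).2 h
  exact h'

end Rewards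

variable [MeasurableSingletonClass ι]

lemma history_le (hS : IsSamba μ r α p₀ R A L) (t : ℕ) : history R A L t ≤ mΩ := by
  refine iSup_le fun s => sup_le (sup_le ?_ ?_) ?_
  · exact (hS.measurable_arm s).comap_le
  · exact (hS.measurable_leader s).comap_le
  · exact (measurable_reward_comp (hS.rewards.measurable s) (hS.measurable_arm s)).comap_le

lemma measurable_prob (hS : IsSamba μ r α p₀ R A L) (hα : Measurable α) (t : ℕ) :
    Measurable (prob α p₀ R A L t) :=
  (measurable_prob_history R A L hα p₀ t).mono (hS.history_le t) le_rfl

lemma measurableSet_choice (hS : IsSamba μ r α p₀ R A L) (t : ℕ) (a l : ι) :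
    MeasurableSet {ω | A t ω = a ∧ L t ω = l} :=
  (hS.measurable_arm t (measurableSet_singleton a)).inter
    (hS.measurable_leader t (measurableSet_singleton l))

/-- The reward of an arm is independent of the history and of the choices. -/
lemma setLIntegral_reward (hS : IsSamba μ r α p₀ R A L) (t : ℕ) (a l b : ι) (x : ℝ)
    {ψ : Ω → ENNReal} (hψ : Measurable[history R A L t] ψ) :
    ∫⁻ ω in {ω | A t ω = a ∧ L t ω = l} ∩ {ω | R t b ω = x}, ψ ω ∂μ
      = μ {ω | R t b ω = x} * ∫⁻ ω in {ω | A t ω = a ∧ L t ω = l}, ψ ω ∂μ := by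
  have h₁ := iSup_le fun a => (hS.rewards.measurable t a).comap_le
  have h₂ := sup_le (sup_le (hS.history_le t) (hS.measurable_arm t).comap_le)
    (hS.measurable_leader t).comap_le
  have hx := le_iSup (fun a => MeasurableSpace.comap (R t a) inferInstance) b _
    ⟨{x}, measurableSet_singleton x, rfl⟩
  have hA := (le_sup_right.trans le_sup_left : MeasurableSpace.comap (A t) inferInstance ≤
    history R A L t ⊔ MeasurableSpace.comap (A t) inferInstance ⊔
      MeasurableSpace.comap (L t) inferInstance) _ ⟨{a}, measurableSet_singleton a, rfl⟩
  have hL := (le_sup_right : MeasurableSpace.comap (L t) inferInstance ≤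
    history R A L t ⊔ MeasurableSpace.comap (A t) inferInstance ⊔
      MeasurableSpace.comap (L t) inferInstance) _ ⟨{l}, measurableSet_singleton l, rfl⟩
  exact setLIntegral_inter_of_indep h₁ h₂ (hS.rewards_indep t) hx (MeasurableSet.inter hA hL)
    (hψ.mono (le_sup_left.trans le_sup_left) le_rfl)

variable [IsProbabilityMeasure μ]

/-- The choice of the arms, integrated against a function of the history. -/
lemma setLIntegral_choice (hS : IsSamba μ r α p₀ R A L) (t : ℕ) (a l : ι) {ψ : Ω → ENNReal}
    (hα : Measurable α) (hψ : Measurable[history R A L t] ψ) :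
    ∫⁻ ω in {ω | A t ω = a ∧ L t ω = l}, ψ ω ∂μ = ∫⁻ ω, ENNReal.ofReal
      (prob α p₀ R A L t ω a * leaderProb (prob α p₀ R A L t ω) l) * ψ ω ∂μ := by
  have hm := hS.history_le t
  have hE := hS.measurableSet_choice t a l
  set E := {ω | A t ω = a ∧ L t ω = l} with hE_def
  set w : Ω → ℝ := fun ω => prob α p₀ R A L t ω a * leaderProb (prob α p₀ R A L t ω) l
    with hw_def
  have hp := hS.measurable_prob hα t
  have hw : Measurable w :=
    ((measurable_pi_apply a).comp hp).mul ((measurable_leaderProb l).comp hp)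
  have hc : μ⟦E | history R A L t⟧ =ᵐ[μ] w := hS.choice t a l
  have hw0 : 0 ≤ᵐ[μ] w := by
    have h : 0 ≤ᵐ[μ] μ⟦E | history R A L t⟧ :=
      condExp_nonneg (ae_of_all _ fun ω => Set.indicator_nonneg (fun _ _ => zero_le_one) ω)
    filter_upwards [h, hc] with ω h1 h2
    rwa [← h2]
  have hwi : Integrable w μ := integrable_condExp.congr hc
  have hμ : (μ.restrict E).trim hm
      = (μ.withDensity fun ω => ENNReal.ofReal (w ω)).trim hm := by
    refine @Measure.ext _ (history R A L t) _ _ fun B hB => ?_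
    rw [trim_measurableSet_eq hm hB, trim_measurableSet_eq hm hB, withDensity_apply _ (hm B hB),
      Measure.restrict_apply (hm B hB), ← ofReal_integral_eq_lintegral_ofReal hwi.integrableOn
        (ae_restrict_of_ae hw0), ← setIntegral_congr_ae (hm B hB) (hc.mono fun ω h _ => h),
      setIntegral_condExp hm ((integrable_const (1 : ℝ)).indicator hE) hB,
      setIntegral_indicator hE, setIntegral_const, smul_eq_mul, mul_one, ofReal_measureReal]
  rw [← lintegral_trim hm hψ, hμ, lintegral_trim hm hψ,
    lintegral_withDensity_eq_lintegral_mul _ hw.ennreal_ofReal (hψ.mono hm le_rfl)]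
  rfl

/-- Given the history up to time `t`, the law of the probabilities at time `t + 1` is the
transition law from the probabilities at time `t`. -/
lemma setLIntegral_prob_succ (hS : IsSamba μ r α p₀ R A L) (hα : Measurable α) (t : ℕ)
    {B : Set Ω} (hB : MeasurableSet[history R A L t] B) {Φ : (ι → ℝ) → ENNReal}
    (hΦ : Measurable Φ) :
    ∫⁻ ω in B, Φ (prob α p₀ R A L (t + 1) ω) ∂μ
      = ∫⁻ ω in B, ∫⁻ x, Φ x ∂transition r α (prob α p₀ R A L t ω) ∂μ := by
  classical
  have hm := hS.history_le t
  have hBm : MeasurableSet B := hm B hB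
  -- the value of `Φ` after the step, given the leading arm `l` and the observed data `z`
  set ψ : ι → (ι → ℝ) → Ω → ENNReal :=
    fun l z => B.indicator fun ω => Φ (update α (prob α p₀ R A L t ω) l z) with hψ_def
  have hψ : ∀ l z, Measurable[history R A L t] (ψ l z) := fun l z =>
    ((hΦ.comp (measurable_update_left hα l z)).comp
      (measurable_prob_history R A L hα p₀ t)).indicator hB
  set E : ι → ι → Set Ω := fun a l => {ω | A t ω = a ∧ L t ω = l} with hE_def
  have hE : ∀ a l, MeasurableSet (E a l) := hS.measurableSet_choice t
  have hR : ∀ a x, MeasurableSet {ω | R t a ω = x} := fun a x =>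
    hS.rewards.measurable t a (measurableSet_singleton x)
  have hdecomp : ∀ᵐ ω ∂μ, B.indicator (fun ω => Φ (prob α p₀ R A L (t + 1) ω)) ω
      = ∑ a, ∑ l, ((E a l ∩ {ω | R t a ω = 1}).indicator (ψ l (Pi.single a 1)) ω +
          (E a l ∩ {ω | R t a ω = 0}).indicator (ψ l 0) ω) := by
    filter_upwards [hS.ae_reward] with ω hω
    rw [Finset.sum_eq_single (A t ω) _ (by simp), Finset.sum_eq_single (L t ω) _ (by simp)]
    · have hmem : ω ∈ E (A t ω) (L t ω) := ⟨rfl, rfl⟩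
      by_cases hωB : ω ∈ B
      · rw [Set.indicator_of_mem hωB]
        rcases hω t (A t ω) with h | h
        · rw [Set.indicator_of_notMem (by simp [h]), Set.indicator_of_mem (Set.mem_inter hmem h), zero_add]
          simp only [hψ_def, Set.indicator_of_mem hωB, prob]
          congr 2
          funext a
          rw [played_mul_eq, h, mul_zero]; rfl
        · rw [Set.indicator_of_mem (Set.mem_inter hmem h), Set.indicator_of_notMem (by simp [h]), add_zero]
          simp only [hψ_def, Set.indicator_of_mem hωB, prob]
          congr 2
          funext a
          rw [played_mul_eq, h, mul_one, played, Pi.single_apply]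
          simp only [eq_comm]
      · rw [Set.indicator_of_notMem hωB]
        simp [hψ_def, Set.indicator_apply, hωB]
    · intro l _ hl
      have : ω ∉ E (A t ω) l := fun h => hl h.2.symm
      simp [this]
    · intro a _ ha
      refine Finset.sum_eq_zero fun l _ => ?_
      have : ω ∉ E a l := fun h => ha h.1.symm
      simp [this]
  have hmeas : ∀ a l x z, Measurable ((E a l ∩ {ω | R t a ω = x}).indicator (ψ l z)) :=
    fun a l x z => ((hψ l z).mono hm le_rfl).indicator ((hE a l).inter (hR a x))
  rw [← lintegral_indicator hBm, lintegral_congr_ae hdecomp,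
    lintegral_sum_sum_add μ (fun a l => hmeas a l _ _) (fun a l => hmeas a l _ _),
    ← lintegral_indicator hBm]
  have hrhs : ∀ ω, B.indicator
      (fun ω => ∫⁻ x, Φ x ∂transition r α (prob α p₀ R A L t ω)) ω
      = ∑ a, ∑ l, (ENNReal.ofReal (r a) * (ENNReal.ofReal (prob α p₀ R A L t ω a *
          leaderProb (prob α p₀ R A L t ω) l) * ψ l (Pi.single a 1) ω) +
        ENNReal.ofReal (1 - r a) * (ENNReal.ofReal (prob α p₀ R A L t ω a *
          leaderProb (prob α p₀ R A L t ω) l) * ψ l 0 ω)) := by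
    intro ω
    by_cases hωB : ω ∈ B
    · simp only [hψ_def, Set.indicator_of_mem hωB, lintegral_transition r α _ hΦ]
      refine Finset.sum_congr rfl fun a _ => Finset.sum_congr rfl fun l _ => ?_
      ring
    · simp [hψ_def, Set.indicator_of_notMem hωB]
  have hp := hS.measurable_prob hα t
  have hw : ∀ a l, Measurable fun ω => ENNReal.ofReal (prob α p₀ R A L t ω a *
      leaderProb (prob α p₀ R A L t ω) l) := fun a l =>
    (((measurable_pi_apply a).comp hp).mul
      ((measurable_leaderProb l).comp hp)).ennreal_ofReal
  have hwψ : ∀ a l z, Measurable fun ω => ENNReal.ofReal (prob α p₀ R A L t ω a *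
      leaderProb (prob α p₀ R A L t ω) l) * ψ l z ω := fun a l z =>
    (hw a l).mul ((hψ l z).mono hm le_rfl)
  rw [lintegral_congr hrhs, lintegral_sum_sum_add μ (fun a l => (hwψ a l _).const_mul _)
    (fun a l => (hwψ a l _).const_mul _)]
  refine Finset.sum_congr rfl fun a _ => Finset.sum_congr rfl fun l _ => ?_
  rw [lintegral_const_mul _ (hwψ a l _), lintegral_const_mul _ (hwψ a l _),
    lintegral_indicator ((hE a l).inter (hR a 1)), lintegral_indicator ((hE a l).inter (hR a 0)),
    hS.setLIntegral_reward t a l a 1 (hψ _ _), hS.setLIntegral_reward t a l a 0 (hψ _ _),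
    hS.setLIntegral_choice t a l hα (hψ _ _), hS.setLIntegral_choice t a l hα (hψ _ _),
    hS.measure_reward_one, hS.measure_reward_zero]

end IsSamba

/-! ### The Markov chain of probabilities and its drift -/

namespace IsSamba

variable {ι Ω : Type*} [Fintype ι] [MeasurableSpace ι] [MeasurableSingletonClass ι]
  {mΩ : MeasurableSpace Ω} {μ : Measure Ω} [IsProbabilityMeasure μ] {r : ι → ℝ} {β : ℝ}
  {p₀ : ι → ℝ} {R : ℕ → ι → Ω → ℝ} {A L : ℕ → Ω → ι}

lemma ae_prob_mem (hS : IsSamba μ r (logRate β) p₀ R A L) (hβ0 : 0 < β) (hβ : β ≤ 1)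
    (hp₀ : p₀ ∈ openSimplex ι) :
    ∀ᵐ ω ∂μ, ∀ t, prob (logRate β) p₀ R A L t ω ∈ openSimplex ι := by
  have hα := measurable_logRate β
  refine ae_all_iff.2 fun t => ?_
  induction t with
  | zero => exact ae_of_all _ fun _ => hp₀
  | succ t ih =>
    have hm : MeasurableSet (openSimplex ι)ᶜ := measurableSet_openSimplex.compl
    have h := hS.setLIntegral_prob_succ hα t (B := Set.univ) MeasurableSet.univ
      (measurable_one.indicator hm)
    simp only [← transition_apply r _ _ hm, Measure.restrict_univ] at h
    have h0 : ∫⁻ ω, transition r (logRate β) (prob (logRate β) p₀ R A L t ω) (openSimplex ι)ᶜ ∂μ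
        = 0 := by
      rw [lintegral_congr_ae (ih.mono fun ω hω => transition_compl_openSimplex hβ0 hβ hω)]
      exact lintegral_zero
    have hmeas : Measurable fun ω => (openSimplex ι)ᶜ.indicator (1 : (ι → ℝ) → ENNReal)
        (prob (logRate β) p₀ R A L (t + 1) ω) :=
      (measurable_one.indicator hm).comp (hS.measurable_prob hα (t + 1))
    rw [h0, lintegral_eq_zero_iff hmeas] at h
    filter_upwards [h] with ω hω
    by_contra hc
    simp [hc] at hω

lemma isMarkovChain [Nonempty ι] (hS : IsSamba μ r (logRate β) p₀ R A L) (hβ0 : 0 < β)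
    (hβ : β ≤ 1) (hr : ∀ a, r a ∈ Set.Icc (0 : ℝ) 1) (hp₀ : p₀ ∈ openSimplex ι) :
    IsMarkovChain μ (openSimplex ι) (transition r (logRate β))
      (prob (logRate β) p₀ R A L) where
  measurableSet_state := measurableSet_openSimplex
  measurable_kernel := measurable_transition (measurable_logRate β) r
  kernel_prob _ hp := isProbabilityMeasure_transition hβ0 hβ hr hp
  kernel_state _ hp := transition_compl_openSimplex hβ0 hβ hp
  measurable := hS.measurable_prob (measurable_logRate β)
  mem_state := hS.ae_prob_mem hβ0 hβ hp₀
  markov t B hB := by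
    have hα := measurable_logRate β
    have hX := hS.measurable_prob hα
    have hκ := measurable_transition hα r
    have hm : (⨆ s : Fin (t + 1), MeasurableSpace.comap (prob (logRate β) p₀ R A L s)
        inferInstance) ≤ mΩ := iSup_le fun s => (hX s).comap_le
    have hmh : (⨆ s : Fin (t + 1), MeasurableSpace.comap (prob (logRate β) p₀ R A L s)
        inferInstance) ≤ history R A L t := by
      refine iSup_le fun s => le_trans ?_ (history_mono R A L (Nat.lt_succ_iff.1 s.2))
      exact (measurable_prob_history R A L hα p₀ s).comap_le
    have hg : Measurable fun ω =>
        transition r (logRate β) (prob (logRate β) p₀ R A L t ω) B :=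
      (Measure.measurable_coe hB).comp (hκ.comp (hX t))
    have hg1 : ∀ᵐ ω ∂μ, transition r (logRate β) (prob (logRate β) p₀ R A L t ω) B ≤ 1 := by
      filter_upwards [hS.ae_prob_mem hβ0 hβ hp₀] with ω hω
      have := isProbabilityMeasure_transition hβ0 hβ hr (hω t)
      exact prob_le_one
    refine (ae_eq_condExp_of_forall_setIntegral_eq hm
      ((integrable_const (1 : ℝ)).indicator (hX (t + 1) hB)) ?_ ?_ ?_).symm
    · intro E _ _
      refine Integrable.integrableOn (Integrable.of_bound
        hg.ennreal_toReal.aestronglyMeasurable 1 ?_)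
      filter_upwards [hg1] with ω hω
      rw [Real.norm_of_nonneg measureReal_nonneg]
      exact ENNReal.toReal_mono ENNReal.one_ne_top hω
    · intro E hE _
      have key := hS.setLIntegral_prob_succ hα t (hmh _ hE) (measurable_one.indicator hB)
      simp only [← transition_apply r _ _ hB] at key
      simp only [measureReal_def]
      rw [integral_toReal hg.aemeasurable (ae_restrict_of_ae
        (hg1.mono fun ω h => h.trans_lt ENNReal.one_lt_top)), ← key,
        setIntegral_indicator (hX (t + 1) hB), setIntegral_const, smul_eq_mul, mul_one,
        measureReal_def]
      congr 1
      have : (fun ω => B.indicator (1 : (ι → ℝ) → ENNReal) (prob (logRate β) p₀ R A L (t + 1) ω))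
          = (prob (logRate β) p₀ R A L (t + 1) ⁻¹' B).indicator 1 := by
        funext ω; rfl
      rw [this, lintegral_indicator_one (hX (t + 1) hB), Measure.restrict_apply (hX (t + 1) hB),
        Set.inter_comm]
    · have h1 : Measurable[⨆ s : Fin (t + 1), MeasurableSpace.comap
          (prob (logRate β) p₀ R A L s) inferInstance] (prob (logRate β) p₀ R A L t) :=
        measurable_iff_comap_le.2 (le_iSup (fun s : Fin (t + 1) => MeasurableSpace.comap
          (prob (logRate β) p₀ R A L s) inferInstance) (Fin.last t))
      have h2 : Measurable fun p => (transition r (logRate β) p B).toReal :=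
        ((Measure.measurable_coe hB).comp hκ).ennreal_toReal
      exact (h2.comp h1).aestronglyMeasurable

/-- A drift inequality on the simplex, integrated over an event of the history. -/
lemma setLIntegral_drift (hS : IsSamba μ r (logRate β) p₀ R A L) (hβ0 : 0 < β)
    (hβ : β ≤ 1) (hr : ∀ a, r a ∈ Set.Icc (0 : ℝ) 1) (hp₀ : p₀ ∈ openSimplex ι)
    {V W : (ι → ℝ) → ℝ} (hV : Measurable V) (hW : Measurable W)
    (hV0 : ∀ p ∈ openSimplex ι, 0 ≤ V p) (hW0 : ∀ p ∈ openSimplex ι, 0 ≤ W p)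
    (h : ∀ p ∈ openSimplex ι, step r (logRate β) V p ≤ V p - W p) (t : ℕ) {B : Set Ω}
    (hB : MeasurableSet[history R A L t] B) :
    ∫⁻ ω in B, ENNReal.ofReal (V (prob (logRate β) p₀ R A L (t + 1) ω)) ∂μ +
      ∫⁻ ω in B, ENNReal.ofReal (W (prob (logRate β) p₀ R A L t ω)) ∂μ
      ≤ ∫⁻ ω in B, ENNReal.ofReal (V (prob (logRate β) p₀ R A L t ω)) ∂μ := by
  have hα := measurable_logRate β
  have hWm : Measurable fun ω => ENNReal.ofReal (W (prob (logRate β) p₀ R A L t ω)) :=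
    (hW.comp (hS.measurable_prob hα t)).ennreal_ofReal
  rw [hS.setLIntegral_prob_succ hα t hB hV.ennreal_ofReal, ← lintegral_add_right _ hWm]
  refine lintegral_mono_ae (ae_restrict_of_ae ?_)
  filter_upwards [hS.ae_prob_mem hβ0 hβ hp₀] with ω hω
  obtain ⟨h1, h2⟩ := lintegral_ofReal_transition hβ0 hβ hr (hω t) hV hV0
  rw [h2, ← ENNReal.ofReal_add h1 (hW0 _ (hω t))]
  refine ENNReal.ofReal_le_ofReal ?_
  linarith [h _ (hω t)]

/-- Summing a drift inequality over time bounds the total expected decrease. -/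
lemma tsum_drift_le (hS : IsSamba μ r (logRate β) p₀ R A L) (hβ0 : 0 < β)
    (hβ : β ≤ 1) (hr : ∀ a, r a ∈ Set.Icc (0 : ℝ) 1) (hp₀ : p₀ ∈ openSimplex ι)
    {V W : (ι → ℝ) → ℝ} (hV : Measurable V) (hW : Measurable W)
    (hV0 : ∀ p ∈ openSimplex ι, 0 ≤ V p) (hW0 : ∀ p ∈ openSimplex ι, 0 ≤ W p)
    (h : ∀ p ∈ openSimplex ι, step r (logRate β) V p ≤ V p - W p) :
    ∑' t, ∫⁻ ω, ENNReal.ofReal (W (prob (logRate β) p₀ R A L t ω)) ∂μ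
      ≤ ENNReal.ofReal (V p₀) := by
  have key : ∀ n, ∫⁻ ω, ENNReal.ofReal (V (prob (logRate β) p₀ R A L n ω)) ∂μ +
      ∑ t ∈ Finset.range n, ∫⁻ ω, ENNReal.ofReal (W (prob (logRate β) p₀ R A L t ω)) ∂μ
      ≤ ENNReal.ofReal (V p₀) := by
    intro n
    induction n with
    | zero => simp [prob]
    | succ n ih =>
      have h1 := hS.setLIntegral_drift hβ0 hβ hr hp₀ hV hW hV0 hW0 h n
        (B := Set.univ) MeasurableSet.univ
      simp only [Measure.restrict_univ] at h1
      rw [Finset.sum_range_succ, add_comm (∑ t ∈ Finset.range n, _), ← add_assoc]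
      exact (add_le_add_left h1 _).trans ih
  exact ENNReal.tsum_le_of_sum_range_le fun n => le_add_self.trans (key n)

variable {Δ : ℝ} {s : ι}

/-- The best arm has probability at most `1 / 2` for a finite expected time. -/
lemma tsum_measure_le_half_ne_top [Nontrivial ι] (hS : IsSamba μ r (logRate β) p₀ R A L)
    (hβ0 : 0 < β) (hβ : β ≤ 1) (hr : ∀ a, r a ∈ Set.Icc (0 : ℝ) 1) (hp₀ : p₀ ∈ openSimplex ι)
    (hΔ0 : 0 < Δ) (hΔ : ∀ a, a ≠ s → Δ ≤ r s - r a) :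
    ∑' t, μ {ω | prob (logRate β) p₀ R A L t ω s ≤ 1 / 2} ≠ ⊤ := by
  obtain ⟨K, c, hK, hc, h⟩ := exists_lyapunov hβ0 hβ (fun a => (hr a).1) (fun a => (hr a).2)
    hΔ0 hΔ
  have hset : MeasurableSet {p : ι → ℝ | p s ≤ 1 / 2} :=
    measurableSet_le (measurable_pi_apply s) measurable_const
  have h1 := hS.tsum_drift_le hβ0 hβ hr hp₀ (V := fun p => (p s ^ 2)⁻¹ + K * (1 - p s))
    (W := fun p => if p s ≤ 1 / 2 then c else 0) (by fun_prop)
    (Measurable.ite hset measurable_const measurable_const)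
    (fun p hp => by
      have := openSimplex.le_one hp s
      have := mul_nonneg hK (sub_nonneg.2 this)
      positivity)
    (fun p _ => by split_ifs <;> [exact hc.le; exact le_rfl]) h
  have h2 : ∀ t, ∫⁻ ω, ENNReal.ofReal (if prob (logRate β) p₀ R A L t ω s ≤ 1 / 2 then c else 0)
      ∂μ = ENNReal.ofReal c * μ {ω | prob (logRate β) p₀ R A L t ω s ≤ 1 / 2} := by
    intro t
    have hm : MeasurableSet {ω | prob (logRate β) p₀ R A L t ω s ≤ 1 / 2} :=
      hS.measurable_prob (measurable_logRate β) t hset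
    rw [← lintegral_indicator_const hm]
    refine lintegral_congr fun ω => ?_
    rw [Set.indicator_apply, apply_ite ENNReal.ofReal, ENNReal.ofReal_zero]
    rfl
  simp only [h2, ENNReal.tsum_mul_left] at h1
  intro htop
  rw [htop, ENNReal.mul_top (by simpa using hc)] at h1
  exact ENNReal.ofReal_ne_top (top_le_iff.1 h1)

lemma summable_measureReal_le_half [Nontrivial ι] (hS : IsSamba μ r (logRate β) p₀ R A L)
    (hβ0 : 0 < β) (hβ : β ≤ 1) (hr : ∀ a, r a ∈ Set.Icc (0 : ℝ) 1) (hp₀ : p₀ ∈ openSimplex ι)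
    (hΔ0 : 0 < Δ) (hΔ : ∀ a, a ≠ s → Δ ≤ r s - r a) :
    Summable fun t => μ.real {ω | prob (logRate β) p₀ R A L t ω s ≤ 1 / 2} :=
  ENNReal.summable_toReal (hS.tsum_measure_le_half_ne_top hβ0 hβ hr hp₀ hΔ0 hΔ)

/-- The losses are summable, hence tend to `0`; since the best arm has probability more than
`1 / 2` eventually, the other probabilities tend to `0`. -/
lemma ae_tendsto_one [Nontrivial ι] (hS : IsSamba μ r (logRate β) p₀ R A L)
    (hβ0 : 0 < β) (hβ : β ≤ 1) (hr : ∀ a, r a ∈ Set.Icc (0 : ℝ) 1) (hp₀ : p₀ ∈ openSimplex ι)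
    (hΔ0 : 0 < Δ) (hΔ : ∀ a, a ≠ s → Δ ≤ r s - r a) :
    ∀ᵐ ω ∂μ, Tendsto (fun t => prob (logRate β) p₀ R A L t ω s) atTop (𝓝 1) := by
  classical
  have hα := measurable_logRate β
  have h1 := hS.tsum_drift_le hβ0 hβ hr hp₀ (V := fun p => 1 - p s) (W := loss Δ β s)
    (by fun_prop) (measurable_loss Δ β s)
    (fun p hp => sub_nonneg.2 (openSimplex.le_one hp s)) (fun p hp => loss_nonneg hβ0 hΔ0 s hp)
    (fun p hp => step_one_sub_le hβ0 hp hΔ0 hΔ)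
  have hmeas : ∀ t, Measurable fun ω =>
      ENNReal.ofReal (loss Δ β s (prob (logRate β) p₀ R A L t ω)) := fun t =>
    ((measurable_loss Δ β s).comp (hS.measurable_prob hα t)).ennreal_ofReal
  rw [← lintegral_tsum fun t => (hmeas t).aemeasurable] at h1
  have h2 := ae_lt_top (Measurable.tsum hmeas) (h1.trans_lt ENNReal.ofReal_lt_top).ne
  have h3 := measure_setOfPred_frequently_eq_zero
    (hS.tsum_measure_le_half_ne_top hβ0 hβ hr hp₀ hΔ0 hΔ)
  have h4 : ∀ᵐ ω ∂μ, ¬ ∃ᶠ t in atTop, prob (logRate β) p₀ R A L t ω s ≤ 1 / 2 := by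
    rw [ae_iff]; simpa only [not_not] using h3
  filter_upwards [h2, h4, hS.ae_prob_mem hβ0 hβ hp₀] with ω hsum hev hmem
  rw [not_frequently] at hev
  have hloss : Tendsto (fun t => loss Δ β s (prob (logRate β) p₀ R A L t ω)) atTop (𝓝 0) := by
    have := (ENNReal.tendsto_toReal ENNReal.zero_ne_top).comp
      (ENNReal.tendsto_atTop_zero_of_tsum_ne_top hsum.ne)
    refine this.congr fun t => ?_
    exact ENNReal.toReal_ofReal (loss_nonneg hβ0 hΔ0 s (hmem t))
  have harm : ∀ a, a ≠ s → Tendsto (fun t => prob (logRate β) p₀ R A L t ω a) atTop (𝓝 0) := by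
    intro a ha
    have hcube : Tendsto (fun t => prob (logRate β) p₀ R A L t ω a ^ 3) atTop (𝓝 0) := by
      have hl := hloss.const_mul (β * Δ)⁻¹
      rw [mul_zero] at hl
      refine tendsto_of_tendsto_of_tendsto_of_le_of_le' tendsto_const_nhds hl
        (Eventually.of_forall fun t => pow_nonneg ((hmem t).1 a).le 3) ?_
      filter_upwards [hev] with t ht
      rw [loss, if_pos (not_le.1 ht), inv_mul_eq_div, le_div_iff₀ (by positivity)]
      have := mul_cube_le_spread hβ0 (hmem t) ha
      nlinarith
    have := hcube.rpow_const (p := (1 / 3 : ℝ)) (Or.inr (by norm_num))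
    rw [Real.zero_rpow (by norm_num)] at this
    refine this.congr fun t => ?_
    rw [← Real.rpow_natCast, ← Real.rpow_mul ((hmem t).1 a).le]
    norm_num
  have hsum0 : Tendsto (fun t => ∑ a ∈ Finset.univ.erase s, prob (logRate β) p₀ R A L t ω a)
      atTop (𝓝 (∑ a ∈ Finset.univ.erase s, 0)) :=
    tendsto_finsetSum _ fun a ha => harm a (Finset.ne_of_mem_erase ha)
  rw [Finset.sum_const_zero] at hsum0
  have := hsum0.const_sub 1
  rw [sub_zero] at this
  refine this.congr fun t => ?_
  rw [openSimplex.sum_erase (hmem t)]; ring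

end IsSamba

/-! ### A logarithmic recursion -/

section Recursion

/-- Convexity of `y ↦ y ^ 2 / (1 - log y)` on `(0, 1]`, in the form of its tangent lines. -/
lemma tangent_le {x y : ℝ} (hx : 0 < x) (hx1 : x ≤ 1) (hy : 0 < y) (hy1 : y ≤ 1) :
    x ^ 2 / (1 - Real.log x) +
        (2 * x / (1 - Real.log x) + x / (1 - Real.log x) ^ 2) * (y - x)
      ≤ y ^ 2 / (1 - Real.log y) := by
  have hlx := Real.log_nonpos hx.le hx1
  have hly := Real.log_nonpos hy.le hy1
  set L := 1 - Real.log x with hL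
  have hL1 : 1 ≤ L := by linarith
  have hL0 : 0 < L := by linarith
  have h1 : 1 - Real.log y ≤ ((L - 1) * y + x) / y := by
    have := Real.log_le_sub_one_of_pos (div_pos hx hy)
    rw [Real.log_div hx.ne' hy.ne'] at this
    have h : ((L - 1) * y + x) / y = L - 1 + x / y := by field_simp
    rw [h]; linarith
  have hM : 0 < (L - 1) * y + x := by nlinarith
  obtain ⟨M, hM_def⟩ : ∃ M, M = (L - 1) * y + x := ⟨_, rfl⟩
  rw [← hM_def] at h1 hM
  have h2 : y ^ 3 / M ≤ y ^ 2 / (1 - Real.log y) := by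
    calc y ^ 3 / M = y ^ 2 / (M / y) := by field_simp
      _ ≤ _ := by
        apply div_le_div_of_nonneg_left (by positivity) (by linarith) h1
  refine le_trans ?_ h2
  have key : y ^ 3 / M - (x ^ 2 / L + (2 * x / L + x / L ^ 2) * (y - x))
      = (y - x) ^ 2 * (L ^ 2 * y + (L + 1) * x) / (L ^ 2 * M) := by
    field_simp
    rw [hM_def]; ring
  have : 0 ≤ (y - x) ^ 2 * (L ^ 2 * y + (L + 1) * x) / (L ^ 2 * M) := by
    positivity
  linarith

/-- One step of the recursion increases `-log w / w` by at least `c`. -/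
lemma neg_log_div_step {c w w' : ℝ} (hc : 0 ≤ c) (hw1 : w ≤ 1) (hw' : 0 < w')
    (h : w' ≤ w - c * (w ^ 2 / (1 - Real.log w))) (hw : 0 < w) :
    -Real.log w / w + c ≤ -Real.log w' / w' := by
  have hlw := Real.log_nonpos hw.le hw1
  set l := -Real.log w with hl
  have hL : 1 - Real.log w = 1 + l := by rw [hl]; ring
  have hl0 : 0 ≤ l := by linarith
  rw [hL] at h
  have hww : w' ≤ w := by
    have : 0 ≤ c * (w ^ 2 / (1 + l)) := by positivity
    linarith
  have h1 : c ≤ (w - w') * (1 + l) / w ^ 2 := by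
    rw [le_div_iff₀ (by positivity)]
    have : c * (w ^ 2 / (1 + l)) * (1 + l) ≤ (w - w') * (1 + l) := by gcongr; linarith
    calc c * w ^ 2 = c * (w ^ 2 / (1 + l)) * (1 + l) := by field_simp
      _ ≤ _ := this
  have h2 : l + (1 - w' / w) ≤ -Real.log w' := by
    have := Real.log_le_sub_one_of_pos (div_pos hw' hw)
    rw [Real.log_div hw'.ne' hw.ne'] at this
    linarith
  have h3 : (l + (1 - w' / w)) / w' ≤ -Real.log w' / w' := by gcongr
  have h4 : (l + (1 - w' / w)) / w' - (l / w + (w - w') * (1 + l) / w ^ 2)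
      = (w - w') ^ 2 * (1 + l) / (w ^ 2 * w') := by field_simp; ring
  have h5 : 0 ≤ (w - w') ^ 2 * (1 + l) / (w ^ 2 * w') := by positivity
  linarith

lemma le_neg_log_div {c : ℝ} (hc : 0 ≤ c) {w : ℕ → ℝ} (hw0 : ∀ k, 0 ≤ w k)
    (hw1 : ∀ k, w k ≤ 1)
    (h : ∀ k, 0 < w k → w (k + 1) ≤ w k - c * (w k ^ 2 / (1 - Real.log (w k))))
    (hz : ∀ k, w (k + 1) ≤ w k) (k : ℕ) (hk : 0 < w k) :
    c * k ≤ -Real.log (w k) / w k := by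
  induction k with
  | zero =>
    have := Real.log_nonpos (hw0 0) (hw1 0)
    simp only [Nat.cast_zero, mul_zero]
    exact div_nonneg (by linarith) (hw0 0)
  | succ k ih =>
    have hk' : 0 < w k := hk.trans_le (hz k)
    have := neg_log_div_step hc (hw1 k) hk (h k hk') hk'
    have := ih hk'
    push_cast
    linarith

lemma le_log_div {s w : ℝ} (hs : Real.exp 1 ≤ s)
    (h : 0 < w → s ≤ -Real.log w / w) : w ≤ Real.log s / s := by
  have hs0 : 0 < s := (Real.exp_pos 1).trans_le hs
  have hl1 : 1 ≤ Real.log s := (Real.le_log_iff_exp_le hs0).2 hs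
  by_contra! hlt
  have hw : 0 < w := lt_trans (by positivity) hlt
  have h1 := (le_div_iff₀ hw).1 (h hw)
  have h2 : Real.log (Real.log s / s) < Real.log w := Real.log_lt_log (by positivity) hlt
  rw [Real.log_div (by linarith) hs0.ne'] at h2
  have h3 := Real.log_nonneg hl1
  have h4 := (div_lt_iff₀ hs0).1 hlt
  linarith

/-- `log x ^ 2 / 2` has derivative `log x / x`, which decreases beyond `e`. -/
lemma log_div_mul_le {a b : ℝ} (ha : Real.exp 1 ≤ a) (hab : a < b) :
    Real.log b / b * (b - a) ≤ (Real.log b ^ 2 - Real.log a ^ 2) / 2 := by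
  have ha0 : 0 < a := (Real.exp_pos 1).trans_le ha
  obtain ⟨x, ⟨hx1, hx2⟩, hx⟩ := exists_hasDerivAt_eq_slope (fun x => Real.log x ^ 2 / 2)
    (fun x => Real.log x / x) hab
    (by
      refine ContinuousOn.div_const (ContinuousOn.pow (Real.continuousOn_log.mono ?_) 2) 2
      intro y hy
      exact (ha0.trans_le hy.1).ne')
    (fun x hx => by
      have h := (((Real.hasDerivAt_log (ha0.trans hx.1).ne').pow 2).div_const 2)
      refine h.congr_deriv ?_
      norm_num
      ring)
  have h1 : Real.log b / b ≤ Real.log x / x :=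
    Real.log_div_self_antitoneOn (ha.trans hx1.le) (ha.trans hab.le) hx2.le
  calc Real.log b / b * (b - a) ≤ Real.log x / x * (b - a) := by
        gcongr
    _ = _ := by
      have := (sub_pos.2 hab).ne'
      rw [hx]; field_simp

/-- A sequence in `[0, 1 / 2]` which decreases at least as in the recursion
`w (k + 1) = w k - c * w k ^ 2 / (1 - log (w k))` for `w = x / n` has partial sums of order
`log ^ 2`. -/
lemma sum_recursion_le {c n : ℝ} (hc : 0 < c) (hn : 1 ≤ n) {x : ℕ → ℝ} (hx0 : ∀ k, 0 ≤ x k)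
    (hx1 : ∀ k, x k ≤ 1 / 2) (hmono : ∀ k, x (k + 1) ≤ x k)
    (h : ∀ k, 0 < x k →
      x (k + 1) ≤ x k - c * n * ((x k / n) ^ 2 / (1 - Real.log (x k / n)))) (T : ℕ) :
    ∑ k ∈ Finset.range T, x k
      ≤ n / (2 * c) * Real.log (c * T) ^ 2 + (⌈Real.exp 1 / c⌉ : ℝ) := by
  have hn0 : 0 < n := by linarith
  have hbound : ∀ k : ℕ, Real.exp 1 ≤ c * k → x k ≤ n * (Real.log (c * k) / (c * k)) := by
    intro k hk
    have hw1 : ∀ k, x k / n ≤ 1 := fun k => by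
      rw [div_le_one hn0]; linarith [hx1 k]
    have h1 := le_log_div hk fun hpos => by
      refine le_neg_log_div hc.le (w := fun k => x k / n) (fun k => div_nonneg (hx0 k) hn0.le)
        hw1 (fun k hk => ?_) (fun k => by gcongr; exact hmono k) k hpos
      have := h k ((div_pos_iff_of_pos_right hn0).1 hk)
      rw [div_le_iff₀ hn0]
      calc x (k + 1) ≤ _ := this
        _ = _ := by
          rw [sub_mul, div_mul_cancel₀ _ hn0.ne']; ring
    rw [div_le_iff₀ hn0] at h1
    linarith
  obtain ⟨K, hK⟩ : ∃ K : ℕ, (K : ℤ) = ⌈Real.exp 1 / c⌉ :=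
    ⟨_, Int.toNat_of_nonneg (Int.ceil_nonneg (by positivity))⟩
  have hK' : (⌈Real.exp 1 / c⌉ : ℝ) = K := by rw [← hK]; simp
  have hKe : Real.exp 1 ≤ c * K := by
    have := Int.le_ceil (Real.exp 1 / c)
    rw [hK', div_le_iff₀ hc] at this
    linarith
  have hK1 : 1 ≤ K := by
    by_contra hlt
    have : K = 0 := by omega
    rw [this] at hKe
    have := Real.exp_pos 1
    simp at hKe; linarith
  rw [hK']
  -- beyond time `K` the sum is compared with the integral of `log (c t) / (c t)`
  have hlong : ∀ m : ℕ, ∑ k ∈ Finset.range (K + 1 + m), x k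
      ≤ K + n / (2 * c) * (Real.log (c * (K + m : ℕ)) ^ 2 - Real.log (c * K) ^ 2) := by
    intro m
    induction m with
    | zero =>
      have h1 : ∑ k ∈ Finset.range (K + 1), x k ≤ ∑ k ∈ Finset.range (K + 1), (1 / 2 : ℝ) :=
        Finset.sum_le_sum fun k _ => hx1 k
      have h2 : (1 : ℝ) ≤ K := by exact_mod_cast hK1
      simp only [Finset.sum_const, Finset.card_range, nsmul_eq_mul] at h1
      push_cast at h1
      simp only [add_zero, sub_self, mul_zero]
      linarith
    | succ m ih =>
      rw [← add_assoc, Finset.sum_range_succ]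
      have ha : Real.exp 1 ≤ c * (K + m : ℕ) := hKe.trans (by gcongr; omega)
      have hab : c * (K + m : ℕ) < c * (K + 1 + m : ℕ) := by gcongr; omega
      have h1 := hbound (K + 1 + m) (ha.trans hab.le)
      have h2 := log_div_mul_le ha hab
      have h3 : c * ((K + 1 + m : ℕ) : ℝ) - c * (K + m : ℕ) = c := by push_cast; ring
      rw [h3] at h2
      have h4 : n * (Real.log (c * (K + 1 + m : ℕ)) / (c * (K + 1 + m : ℕ)))
          ≤ n / (2 * c) * (Real.log (c * (K + 1 + m : ℕ)) ^ 2 -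
            Real.log (c * (K + m : ℕ)) ^ 2) := by
        calc n * (Real.log (c * (K + 1 + m : ℕ)) / (c * (K + 1 + m : ℕ)))
            = n / c * (Real.log (c * (K + 1 + m : ℕ)) / (c * (K + 1 + m : ℕ)) * c) := by
              field_simp
          _ ≤ n / c * ((Real.log (c * (K + 1 + m : ℕ)) ^ 2 -
            Real.log (c * (K + m : ℕ)) ^ 2) / 2) := by gcongr
          _ = _ := by ring
      have h5 : K + (m + 1) = K + 1 + m := by omega
      rw [h5]
      linarith
  rcases le_or_gt T K with hT | hT
  · have h1 : ∑ k ∈ Finset.range T, x k ≤ ∑ k ∈ Finset.range T, (1 : ℝ) :=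
      Finset.sum_le_sum fun k _ => by linarith [hx1 k]
    simp only [Finset.sum_const, Finset.card_range, nsmul_eq_mul, mul_one] at h1
    have h2 : (T : ℝ) ≤ K := by exact_mod_cast hT
    have h3 : 0 ≤ n / (2 * c) * Real.log (c * T) ^ 2 := by positivity
    linarith
  · obtain ⟨m, rfl⟩ : ∃ m, T = K + 1 + m := ⟨T - (K + 1), by omega⟩
    have h1 := hlong m
    have h2 : n / (2 * c) * (Real.log (c * (K + m : ℕ)) ^ 2 - Real.log (c * K) ^ 2)
        ≤ n / (2 * c) * Real.log (c * (K + 1 + m : ℕ)) ^ 2 := by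
      have ha : Real.exp 1 ≤ c * (K + m : ℕ) := hKe.trans (by gcongr; omega)
      have he := Real.add_one_le_exp (1 : ℝ)
      have h3 : 0 ≤ Real.log (c * (K + m : ℕ)) := Real.log_nonneg (by linarith)
      have h4 : Real.log (c * (K + m : ℕ)) ≤ Real.log (c * (K + 1 + m : ℕ)) := by
        apply Real.log_le_log (by linarith)
        gcongr; omega
      have h5 : Real.log (c * (K + m : ℕ)) ^ 2 ≤ Real.log (c * (K + 1 + m : ℕ)) ^ 2 := by
        gcongr
      have h6 := sq_nonneg (Real.log (c * K))
      gcongr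
      linarith
    linarith

end Recursion

/-! ### Visits of the region where the best arm dominates -/

section Visits

variable {Ω : Type*}

open Classical in
/-- The number of times `u < t` at which the event `S u` holds. -/
def visits (S : ℕ → Set Ω) (t : ℕ) (ω : Ω) : ℕ :=
  ∑ u ∈ Finset.range t, if ω ∈ S u then 1 else 0

/-- The event that time `t` is the visit number `k` of the events `S`, counted from `0`. -/
def visitAt (S : ℕ → Set Ω) (k t : ℕ) : Set Ω := {ω | visits S t ω = k} ∩ S t

variable {S : ℕ → Set Ω}

lemma visits_succ_of_mem {t : ℕ} {ω : Ω} (h : ω ∈ S t) :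
    visits S (t + 1) ω = visits S t ω + 1 := by
  rw [visits, Finset.sum_range_succ, if_pos h, visits]

lemma visits_succ_of_notMem {t : ℕ} {ω : Ω} (h : ω ∉ S t) :
    visits S (t + 1) ω = visits S t ω := by
  rw [visits, Finset.sum_range_succ, if_neg h, visits, add_zero]

lemma visits_mono {t u : ℕ} (h : t ≤ u) (ω : Ω) : visits S t ω ≤ visits S u ω :=
  Finset.sum_le_sum_of_subset (by simpa using h)

lemma visits_le (t : ℕ) (ω : Ω) : visits S t ω ≤ t := by
  classical
  calc visits S t ω ≤ ∑ _u ∈ Finset.range t, 1 :=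
        Finset.sum_le_sum fun u _ => by split_ifs <;> simp
    _ = t := by simp

lemma setOf_visits_succ (k t : ℕ) :
    {ω | visits S (t + 1) ω = k + 1} = ({ω | visits S t ω = k + 1} \ S t) ∪ visitAt S k t := by
  ext ω
  by_cases h : ω ∈ S t
  · simp [visitAt, visits_succ_of_mem h, h]
  · simp [visitAt, visits_succ_of_notMem h, h]

lemma disjoint_visitAt (k : ℕ) : Pairwise (Function.onFun Disjoint (visitAt S k)) := by
  have key : ∀ t u, t < u → Disjoint (visitAt S k t) (visitAt S k u) := by
    intro t u htu
    rw [Set.disjoint_left]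
    rintro ω ⟨h1, h2⟩ ⟨h3, _⟩
    have h4 := visits_mono (S := S) (Nat.succ_le_of_lt htu) ω
    have h1' : visits S t ω = k := h1
    have h3' : visits S u ω = k := h3
    rw [Nat.succ_eq_add_one, visits_succ_of_mem h2] at h4
    omega
  intro t u htu
  rcases lt_or_gt_of_ne htu with h | h
  · exact key t u h
  · exact (key u t h).symm

lemma measurableSet_visits {m : MeasurableSpace Ω} {t : ℕ} (hS : ∀ u < t, MeasurableSet (S u))
    (k : ℕ) : MeasurableSet {ω | visits S t ω = k} := by
  classical
  have : Measurable (visits S t) := by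
    unfold visits
    exact Finset.measurable_sum _ fun u hu =>
      Measurable.ite (hS u (Finset.mem_range.1 hu)) measurable_const measurable_const
  exact this (measurableSet_singleton k)

variable {mΩ : MeasurableSpace Ω} {μ : Measure Ω}

lemma sum_measureReal_visitAt_le [IsProbabilityMeasure μ] (hS : ∀ t, MeasurableSet (S t)) (k T : ℕ) :
    ∑ t ∈ Finset.range T, μ.real (visitAt S k t) ≤ 1 := by
  rw [← measureReal_biUnion_finset (fun t _ u _ h => disjoint_visitAt k h)
    fun t _ => (measurableSet_visits (fun u _ => hS u) k).inter (hS t)]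
  exact measureReal_le_one

/-- Every time in `S` is a visit with some number. -/
lemma sum_setIntegral_visitAt (hS : ∀ t, MeasurableSet (S t)) {f : Ω → ℝ} (hf : Integrable f μ)
    {t T : ℕ} (htT : t < T) :
    ∑ k ∈ Finset.range T, ∫ ω in visitAt S k t, f ω ∂μ = ∫ ω in S t, f ω ∂μ := by
  have h : S t = ⋃ k ∈ Finset.range T, visitAt S k t := by
    ext ω
    simp only [visitAt, Set.mem_iUnion, Finset.mem_range, Set.mem_inter_iff, exists_prop]
    refine ⟨fun h => ⟨visits S t ω, (visits_le t ω).trans_lt htT, rfl, h⟩, ?_⟩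
    rintro ⟨_, _, _, h⟩; exact h
  conv_rhs => rw [h]
  have hm : ∀ k ∈ Finset.range T, MeasurableSet (visitAt S k t) := fun k _ =>
    (measurableSet_visits (fun u _ => hS u) k).inter (hS t)
  rw [integral_biUnion_finset _ hm _ fun k _ => hf.integrableOn]
  intro k _ j _ hkj
  rw [Function.onFun, Set.disjoint_left]
  rintro ω ⟨h1, _⟩ ⟨h2, _⟩
  exact hkj (h1.symm.trans h2)

/-- A drift inequality survives the restriction to the times of visits: between the visits
number `k` and `k + 1` the mean of `q` decreases at least by the loss `d` at visit `k`. -/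
lemma sum_setIntegral_visitAt_succ_le {𝓗 : ℕ → MeasurableSpace Ω} (h𝓗 : ∀ t, 𝓗 t ≤ mΩ)
    (h𝓗m : Monotone 𝓗) (hS : ∀ t, MeasurableSet[𝓗 t] (S t)) {q d : ℕ → Ω → ℝ}
    (hq : ∀ t, Integrable (q t) μ) (hq0 : ∀ t, 0 ≤ᵐ[μ] q t) (hd0 : ∀ t, 0 ≤ᵐ[μ] d t)
    (hdrift : ∀ t B, MeasurableSet[𝓗 t] B →
      ∫ ω in B, q (t + 1) ω ∂μ + ∫ ω in B, d t ω ∂μ ≤ ∫ ω in B, q t ω ∂μ) (k T : ℕ) :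
    ∑ t ∈ Finset.range T, ∫ ω in visitAt S (k + 1) t, q t ω ∂μ +
        ∑ t ∈ Finset.range T, ∫ ω in visitAt S k t, d t ω ∂μ
      ≤ ∑ t ∈ Finset.range T, ∫ ω in visitAt S k t, q t ω ∂μ := by
  have hvis : ∀ k t, MeasurableSet[𝓗 t] {ω | visits S t ω = k} := fun k t =>
    measurableSet_visits (fun u hu => h𝓗m hu.le _ (hS u)) k
  have hat : ∀ k t, MeasurableSet[𝓗 t] (visitAt S k t) := fun k t =>
    MeasurableSet.inter (hvis k t) (hS t)
  have hout : ∀ k t, MeasurableSet[𝓗 t] ({ω | visits S t ω = k} \ S t) := fun k t =>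
    MeasurableSet.diff (hvis k t) (hS t)
  have key : ∫ ω in {ω | visits S T ω = k + 1}, q T ω ∂μ +
      (∑ t ∈ Finset.range T, ∫ ω in visitAt S (k + 1) t, q t ω ∂μ +
        ∑ t ∈ Finset.range T, ∫ ω in visitAt S k t, d t ω ∂μ)
      ≤ ∑ t ∈ Finset.range T, ∫ ω in visitAt S k t, q t ω ∂μ := by
    induction T with
    | zero => simp [visits]
    | succ T ih =>
      have h1 : ∫ ω in {ω | visits S (T + 1) ω = k + 1}, q (T + 1) ω ∂μ
          = ∫ ω in {ω | visits S T ω = k + 1} \ S T, q (T + 1) ω ∂μ +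
            ∫ ω in visitAt S k T, q (T + 1) ω ∂μ := by
        rw [setOf_visits_succ, setIntegral_union _ (h𝓗 T _ (hat k T)) (hq _).integrableOn
          (hq _).integrableOn]
        exact Set.disjoint_left.2 fun ω h h' => h.2 h'.2
      have h2 : ∫ ω in {ω | visits S T ω = k + 1}, q T ω ∂μ
          = ∫ ω in visitAt S (k + 1) T, q T ω ∂μ +
            ∫ ω in {ω | visits S T ω = k + 1} \ S T, q T ω ∂μ :=
        (integral_inter_add_sdiff (h𝓗 T _ (hS T)) (hq T).integrableOn).symm
      have h3 := hdrift T _ (hout (k + 1) T)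
      have h4 := hdrift T _ (hat k T)
      have h5 : 0 ≤ ∫ ω in {ω | visits S T ω = k + 1} \ S T, d T ω ∂μ :=
        integral_nonneg_of_ae (ae_restrict_of_ae (hd0 T))
      simp only [Finset.sum_range_succ]
      linarith
  have h0 : 0 ≤ ∫ ω in {ω | visits S T ω = k + 1}, q T ω ∂μ :=
    integral_nonneg_of_ae (ae_restrict_of_ae (hq0 T))
  linarith

end Visits

/-! ### The regret -/

section Gap

variable {ι : Type*} [Fintype ι] {r : ι → ℝ} {s : ι}

lemma gap_le {a : ι} (ha : a ≠ s) : gap r s ≤ r s - r a := by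
  have : r a ≤ ⨆ a : {a : ι // a ≠ s}, r a :=
    le_ciSup (f := fun a : {a : ι // a ≠ s} => r a) (Set.finite_range _).bddAbove ⟨a, ha⟩
  unfold gap
  linarith

lemma gap_pos [Nontrivial ι] (h : ∀ a, a ≠ s → r a < r s) : 0 < gap r s := by
  obtain ⟨b, hb⟩ := exists_ne s
  have : Nonempty {a : ι // a ≠ s} := ⟨⟨b, hb⟩⟩
  obtain ⟨a, ha⟩ := exists_eq_ciSup_of_finite (f := fun a : {a : ι // a ≠ s} => r a)
  rw [gap, ← ha]
  exact sub_pos.2 (h a a.2)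

lemma iSup_eq_of_forall_lt (h : ∀ a, a ≠ s → r a < r s) : ⨆ a, r a = r s := by
  have : Nonempty ι := ⟨s⟩
  refine le_antisymm (ciSup_le fun a => ?_) (le_ciSup (Set.finite_range r).bddAbove s)
  by_cases ha : a = s
  · rw [ha]
  · exact (h a ha).le

open Classical in
/-- Jensen's inequality over the arms for the convex function `y ^ 2 / (1 - log y)`, linearized
at a point `x`. -/
lemma le_spread_tangent {β x : ℝ} (hβ0 : 0 < β) {p : ι → ℝ} (hp : p ∈ openSimplex ι)
    (hx : 0 < x) (hx1 : x ≤ 1) :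
    β * ((Finset.univ.erase s).card * (x ^ 2 / (1 - Real.log x)) +
      (2 * x / (1 - Real.log x) + x / (1 - Real.log x) ^ 2) *
        (1 - p s - (Finset.univ.erase s).card * x)) ≤ spread (logRate β) p s := by
  have h : ∀ b, logRate β (p b) * p b ^ 2 = β * (p b ^ 2 / (1 - Real.log (p b))) := by
    intro b; rw [logRate]; ring
  rw [spread, Finset.sum_congr rfl fun b _ => h b, ← Finset.mul_sum]
  refine mul_le_mul_of_nonneg_left ?_ hβ0.le
  refine le_trans (le_of_eq ?_) (Finset.sum_le_sum fun b _ =>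
    tangent_le hx hx1 (hp.1 b) (openSimplex.le_one hp b))
  rw [Finset.sum_add_distrib, Finset.sum_const, nsmul_eq_mul, ← Finset.mul_sum,
    Finset.sum_sub_distrib, Finset.sum_const, nsmul_eq_mul, openSimplex.sum_erase hp]

end Gap

namespace IsSamba

variable {ι Ω : Type*} [Fintype ι] [MeasurableSpace ι] [MeasurableSingletonClass ι]
  {mΩ : MeasurableSpace Ω} {μ : Measure Ω} [IsProbabilityMeasure μ] {r : ι → ℝ} {β Δ : ℝ}
  {p₀ : ι → ℝ} {R : ℕ → ι → Ω → ℝ} {A L : ℕ → Ω → ι} {s : ι}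

lemma integrable_prob (hS : IsSamba μ r (logRate β) p₀ R A L) (hβ0 : 0 < β)
    (hβ : β ≤ 1) (hp₀ : p₀ ∈ openSimplex ι) (t : ℕ) (a : ι) :
    Integrable (fun ω => prob (logRate β) p₀ R A L t ω a) μ := by
  refine Integrable.of_bound ((measurable_pi_apply a).comp
    (hS.measurable_prob (measurable_logRate β) t)).aestronglyMeasurable 1 ?_
  filter_upwards [hS.ae_prob_mem hβ0 hβ hp₀] with ω hω
  rw [Real.norm_of_nonneg ((hω t).1 a).le]
  exact openSimplex.le_one (hω t) a

/-- The mean reward collected from arm `a` at time `t` is `r a` times the mean probability of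
playing it. -/
lemma integral_played_mul [Nonempty ι] (hS : IsSamba μ r (logRate β) p₀ R A L) (hβ0 : 0 < β)
    (hβ : β ≤ 1) (hr : ∀ a, r a ∈ Set.Icc (0 : ℝ) 1) (hp₀ : p₀ ∈ openSimplex ι) (t : ℕ)
    (a : ι) :
    Integrable (fun ω => played A t a ω * R t a ω) μ ∧
    ∫ ω, played A t a ω * R t a ω ∂μ = r a * ∫ ω, prob (logRate β) p₀ R A L t ω a ∂μ := by
  classical
  have hα := measurable_logRate β
  have hp := hS.measurable_prob hα t
  have hE := hS.measurableSet_choice t a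
  have hR : MeasurableSet {ω | R t a ω = 1} :=
    hS.rewards.measurable t a (measurableSet_singleton 1)
  have hF : MeasurableSet ({ω | A t ω = a} ∩ {ω | R t a ω = 1}) :=
    (hS.measurable_arm t (measurableSet_singleton a)).inter hR
  have hae : (fun ω => played A t a ω * R t a ω)
      =ᵐ[μ] ({ω | A t ω = a} ∩ {ω | R t a ω = 1}).indicator fun _ => (1 : ℝ) := by
    filter_upwards [hS.ae_reward] with ω hω
    by_cases h : A t ω = a <;> rcases hω t a with h' | h' <;> simp [played, h, h']
  refine ⟨((integrable_const 1).indicator hF).congr hae.symm, ?_⟩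
  have hunion : {ω | A t ω = a} ∩ {ω | R t a ω = 1}
      = ⋃ l, ({ω | A t ω = a ∧ L t ω = l} ∩ {ω | R t a ω = 1}) := by
    ext ω; simp
  have hdisj : Pairwise (Function.onFun Disjoint fun l =>
      {ω | A t ω = a ∧ L t ω = l} ∩ {ω | R t a ω = 1}) := by
    intro l l' hll
    rw [Function.onFun, Set.disjoint_left]
    rintro ω ⟨⟨_, h1⟩, _⟩ ⟨⟨_, h2⟩, _⟩
    exact hll (h1.symm.trans h2)
  have hterm : ∀ l, μ ({ω | A t ω = a ∧ L t ω = l} ∩ {ω | R t a ω = 1})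
      = ENNReal.ofReal (r a) * ∫⁻ ω, ENNReal.ofReal (prob (logRate β) p₀ R A L t ω a *
        leaderProb (prob (logRate β) p₀ R A L t ω) l) ∂μ := by
    intro l
    have h1 := hS.setLIntegral_reward t a l a 1 (ψ := fun _ => 1) measurable_const
    have h2 := hS.setLIntegral_choice t a l hα (ψ := fun _ => 1) measurable_const
    rw [h2, setLIntegral_const, one_mul, hS.measure_reward_one] at h1
    simpa using h1
  have hw : ∀ l, Measurable fun ω => ENNReal.ofReal (prob (logRate β) p₀ R A L t ω a *
      leaderProb (prob (logRate β) p₀ R A L t ω) l) := fun l =>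
    (((measurable_pi_apply a).comp hp).mul ((measurable_leaderProb l).comp hp)).ennreal_ofReal
  have hmeas : μ ({ω | A t ω = a} ∩ {ω | R t a ω = 1})
      = ENNReal.ofReal (r a) *
        ENNReal.ofReal (∫ ω, prob (logRate β) p₀ R A L t ω a ∂μ) := by
    rw [hunion, measure_iUnion hdisj fun l => (hE l).inter hR, tsum_fintype,
      Finset.sum_congr rfl fun l _ => hterm l, ← Finset.mul_sum,
      ← lintegral_finsetSum _ fun l _ => hw l,
      ofReal_integral_eq_lintegral_ofReal (hS.integrable_prob hβ0 hβ hp₀ t a)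
        ((hS.ae_prob_mem hβ0 hβ hp₀).mono fun ω hω => ((hω t).1 a).le)]
    congr 1
    refine lintegral_congr_ae ((hS.ae_prob_mem hβ0 hβ hp₀).mono fun ω hω => ?_)
    simp only
    rw [← ENNReal.ofReal_sum_of_nonneg fun l _ => mul_nonneg ((hω t).1 a).le
      (leaderProb_nonneg _ l), ← Finset.mul_sum, sum_leaderProb, mul_one]
  have h0 : 0 ≤ ∫ ω, prob (logRate β) p₀ R A L t ω a ∂μ :=
    integral_nonneg_of_ae ((hS.ae_prob_mem hβ0 hβ hp₀).mono fun ω hω => ((hω t).1 a).le)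
  rw [integral_congr_ae hae, integral_indicator_const _ hF, smul_eq_mul, mul_one,
    measureReal_def, hmeas, ENNReal.toReal_mul, ENNReal.toReal_ofReal (hr a).1,
    ENNReal.toReal_ofReal h0]

lemma regret_le_sum [Nonempty ι] (hS : IsSamba μ r (logRate β) p₀ R A L) (hβ0 : 0 < β)
    (hβ : β ≤ 1) (hr : ∀ a, r a ∈ Set.Icc (0 : ℝ) 1) (hp₀ : p₀ ∈ openSimplex ι)
    (hs : ∀ a, a ≠ s → r a < r s) (T : ℕ) :
    regret μ r R A T
      ≤ ∑ t ∈ Finset.range T, ∫ ω, (1 - prob (logRate β) p₀ R A L t ω s) ∂μ := by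
  have hplay := hS.integral_played_mul hβ0 hβ hr hp₀
  rw [regret, iSup_eq_of_forall_lt hs, integral_finsetSum _ fun t _ =>
    integrable_finsetSum _ fun a _ => (hplay t a).1]
  have hT : r s * T = ∑ t ∈ Finset.range T, r s := by simp [mul_comm]
  rw [hT, ← Finset.sum_sub_distrib]
  refine Finset.sum_le_sum fun t _ => ?_
  rw [integral_finsetSum _ fun a _ => (hplay t a).1,
    Finset.sum_congr rfl fun a _ => (hplay t a).2,
    integral_sub (integrable_const _) (hS.integrable_prob hβ0 hβ hp₀ t s), integral_const,
    probReal_univ, one_smul]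
  have h0 : ∀ a, 0 ≤ ∫ ω, prob (logRate β) p₀ R A L t ω a ∂μ := fun a =>
    integral_nonneg_of_ae ((hS.ae_prob_mem hβ0 hβ hp₀).mono fun ω hω => ((hω t).1 a).le)
  have h1 : ∫ ω, prob (logRate β) p₀ R A L t ω s ∂μ ≤ 1 := by
    have := integral_mono_ae (hS.integrable_prob hβ0 hβ hp₀ t s) (integrable_const (1 : ℝ))
      ((hS.ae_prob_mem hβ0 hβ hp₀).mono fun ω hω => openSimplex.le_one (hω t) s)
    simpa using this
  have h2 : r s * ∫ ω, prob (logRate β) p₀ R A L t ω s ∂μ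
      ≤ ∑ a, r a * ∫ ω, prob (logRate β) p₀ R A L t ω a ∂μ :=
    Finset.single_le_sum (f := fun a => r a * ∫ ω, prob (logRate β) p₀ R A L t ω a ∂μ)
      (fun a _ => mul_nonneg (hr a).1 (h0 a)) (Finset.mem_univ s)
  have h3 := (hr s).2
  nlinarith

lemma integrable_loss [Nontrivial ι] (hS : IsSamba μ r (logRate β) p₀ R A L) (hβ0 : 0 < β)
    (hβ : β ≤ 1) (hr : ∀ a, r a ∈ Set.Icc (0 : ℝ) 1) (hp₀ : p₀ ∈ openSimplex ι)
    (hΔ0 : 0 < Δ) (hΔ : ∀ a, a ≠ s → Δ ≤ r s - r a) (t : ℕ) :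
    Integrable (fun ω => loss Δ β s (prob (logRate β) p₀ R A L t ω)) μ := by
  refine Integrable.of_bound ((measurable_loss Δ β s).comp
    (hS.measurable_prob (measurable_logRate β) t)).aestronglyMeasurable 1 ?_
  filter_upwards [hS.ae_prob_mem hβ0 hβ hp₀] with ω hω
  rw [Real.norm_of_nonneg (loss_nonneg hβ0 hΔ0 s (hω t))]
  have h1 := (lintegral_ofReal_transition hβ0 hβ hr (hω t) (V := fun p => 1 - p s)
    (by fun_prop) fun p hp => sub_nonneg.2 (openSimplex.le_one hp s)).1
  have h2 := step_one_sub_le hβ0 (hω t) hΔ0 hΔ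
  have h3 := (hω t).1 s
  linarith

lemma setIntegral_drift [Nontrivial ι] (hS : IsSamba μ r (logRate β) p₀ R A L) (hβ0 : 0 < β)
    (hβ : β ≤ 1) (hr : ∀ a, r a ∈ Set.Icc (0 : ℝ) 1) (hp₀ : p₀ ∈ openSimplex ι)
    (hΔ0 : 0 < Δ) (hΔ : ∀ a, a ≠ s → Δ ≤ r s - r a) (t : ℕ) {B : Set Ω}
    (hB : MeasurableSet[history R A L t] B) :
    ∫ ω in B, (1 - prob (logRate β) p₀ R A L (t + 1) ω s) ∂μ +
      ∫ ω in B, loss Δ β s (prob (logRate β) p₀ R A L t ω) ∂μ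
      ≤ ∫ ω in B, (1 - prob (logRate β) p₀ R A L t ω s) ∂μ := by
  have hq : ∀ t, Integrable (fun ω => 1 - prob (logRate β) p₀ R A L t ω s) μ := fun t =>
    (integrable_const 1).sub (hS.integrable_prob hβ0 hβ hp₀ t s)
  have hq0 : ∀ t, 0 ≤ᵐ[μ.restrict B] fun ω => 1 - prob (logRate β) p₀ R A L t ω s := fun t =>
    ae_restrict_of_ae ((hS.ae_prob_mem hβ0 hβ hp₀).mono fun ω hω =>
      sub_nonneg.2 (openSimplex.le_one (hω t) s))
  have hl0 : 0 ≤ᵐ[μ.restrict B] fun ω => loss Δ β s (prob (logRate β) p₀ R A L t ω) :=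
    ae_restrict_of_ae ((hS.ae_prob_mem hβ0 hβ hp₀).mono fun ω hω =>
      loss_nonneg hβ0 hΔ0 s (hω t))
  have h := hS.setLIntegral_drift hβ0 hβ hr hp₀ (V := fun p => 1 - p s) (W := loss Δ β s)
    (by fun_prop) (measurable_loss Δ β s)
    (fun p hp => sub_nonneg.2 (openSimplex.le_one hp s)) (fun p hp => loss_nonneg hβ0 hΔ0 s hp)
    (fun p hp => step_one_sub_le hβ0 hp hΔ0 hΔ) t hB
  rw [← ofReal_integral_eq_lintegral_ofReal (hq (t + 1)).integrableOn (hq0 (t + 1)),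
    ← ofReal_integral_eq_lintegral_ofReal
      (hS.integrable_loss hβ0 hβ hr hp₀ hΔ0 hΔ t).integrableOn hl0,
    ← ofReal_integral_eq_lintegral_ofReal (hq t).integrableOn (hq0 t),
    ← ENNReal.ofReal_add (integral_nonneg_of_ae (hq0 (t + 1))) (integral_nonneg_of_ae hl0)] at h
  exact (ENNReal.ofReal_le_ofReal_iff (integral_nonneg_of_ae (hq0 t))).1 h

/-- The regret while the best arm has probability more than `1 / 2`. The mean of `1 - p s` at
the successive visits of this region obeys the recursion of `sum_recursion_le`. -/
lemma sum_setIntegral_le [Nontrivial ι] (hS : IsSamba μ r (logRate β) p₀ R A L) (hβ0 : 0 < β)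
    (hβ : β ≤ 1) (hr : ∀ a, r a ∈ Set.Icc (0 : ℝ) 1) (hp₀ : p₀ ∈ openSimplex ι)
    (hΔ0 : 0 < Δ) (hΔ : ∀ a, a ≠ s → Δ ≤ r s - r a) (T : ℕ) :
    ∑ t ∈ Finset.range T, ∫ ω in {ω | 1 / 2 < prob (logRate β) p₀ R A L t ω s},
        (1 - prob (logRate β) p₀ R A L t ω s) ∂μ
      ≤ (Fintype.card ι : ℝ) / (2 * β * Δ) * Real.log (β * Δ * T) ^ 2 +
        (⌈Real.exp 1 / (β * Δ)⌉ : ℝ) := by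
  classical
  have hα := measurable_logRate β
  have hmem := hS.ae_prob_mem hβ0 hβ hp₀
  set q : ℕ → Ω → ℝ := fun t ω => 1 - prob (logRate β) p₀ R A L t ω s with hq_def
  set d : ℕ → Ω → ℝ := fun t ω => loss Δ β s (prob (logRate β) p₀ R A L t ω) with hd_def
  set S : ℕ → Set Ω := fun t => {ω | 1 / 2 < prob (logRate β) p₀ R A L t ω s} with hS_def
  have hSt : ∀ t, MeasurableSet[history R A L t] (S t) := fun t =>
    measurable_prob_history R A L hα p₀ t
      (measurableSet_lt measurable_const (measurable_pi_apply s))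
  have hSm : ∀ t, MeasurableSet (S t) := fun t => hS.history_le t _ (hSt t)
  have hat : ∀ k t, MeasurableSet (visitAt S k t) := fun k t =>
    (measurableSet_visits (fun u _ => hSm u) k).inter (hSm t)
  have hq : ∀ t, Integrable (q t) μ := fun t =>
    (integrable_const 1).sub (hS.integrable_prob hβ0 hβ hp₀ t s)
  have hq0 : ∀ t, 0 ≤ᵐ[μ] q t := fun t => hmem.mono fun ω hω =>
    sub_nonneg.2 (openSimplex.le_one (hω t) s)
  have hd : ∀ t, Integrable (d t) μ := hS.integrable_loss hβ0 hβ hr hp₀ hΔ0 hΔ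
  have hd0 : ∀ t, 0 ≤ᵐ[μ] d t := fun t => hmem.mono fun ω hω => loss_nonneg hβ0 hΔ0 s (hω t)
  -- the mean of `1 - p s` at visit number `k`
  set x : ℕ → ℝ := fun k => ∑ t ∈ Finset.range T, ∫ ω in visitAt S k t, q t ω ∂μ with hx_def
  have hx0 : ∀ k, 0 ≤ x k := fun k => Finset.sum_nonneg fun t _ =>
    integral_nonneg_of_ae (ae_restrict_of_ae (hq0 t))
  have hP : ∀ k, ∑ t ∈ Finset.range T, μ.real (visitAt S k t) ≤ 1 := fun k =>
    sum_measureReal_visitAt_le hSm k T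
  have hx1 : ∀ k, x k ≤ 1 / 2 := by
    intro k
    calc x k ≤ ∑ t ∈ Finset.range T, 1 / 2 * μ.real (visitAt S k t) := by
          refine Finset.sum_le_sum fun t _ => ?_
          have h1 : ∫ ω in visitAt S k t, q t ω ∂μ ≤ ∫ _ω in visitAt S k t, (1 / 2 : ℝ) ∂μ := by
            refine setIntegral_mono_on (hq t).integrableOn (integrable_const _).integrableOn
              (hat k t) fun ω hω => ?_
            have : 1 / 2 < prob (logRate β) p₀ R A L t ω s := hω.2
            simp only [hq_def]; linarith
          rw [setIntegral_const, smul_eq_mul] at h1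
          linarith
      _ ≤ 1 / 2 := by
          rw [← Finset.mul_sum]; linarith [hP k]
  have hdrift := sum_setIntegral_visitAt_succ_le hS.history_le
    (fun t u htu => history_mono R A L htu) hSt hq hq0 hd0
    (fun t B hB => hS.setIntegral_drift hβ0 hβ hr hp₀ hΔ0 hΔ t hB)
  have hmono : ∀ k, x (k + 1) ≤ x k := fun k => by
    have h1 := hdrift k T
    have h2 : 0 ≤ ∑ t ∈ Finset.range T, ∫ ω in visitAt S k t, d t ω ∂μ :=
      Finset.sum_nonneg fun t _ => integral_nonneg_of_ae (ae_restrict_of_ae (hd0 t))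
    linarith
  set n : ℝ := ((Finset.univ.erase s).card : ℝ) with hn_def
  have hn : 1 ≤ n := by
    obtain ⟨b, hb⟩ := exists_ne s
    have : 0 < (Finset.univ.erase s).card := Finset.card_pos.2 ⟨b, by simp [hb]⟩
    rw [hn_def]; exact_mod_cast this
  have hn0 : 0 < n := by linarith
  have hnN : n ≤ Fintype.card ι := by
    rw [hn_def]; exact_mod_cast Finset.card_le_univ _
  have hrec : ∀ k, 0 < x k →
      x (k + 1) ≤ x k - β * Δ * n * ((x k / n) ^ 2 / (1 - Real.log (x k / n))) := by
    intro k hk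
    -- linearize the convex function at the mean probability per suboptimal arm
    set ξ := x k / n with hξ_def
    have hξ : 0 < ξ := div_pos hk hn0
    have hξ1 : ξ ≤ 1 := by rw [hξ_def, div_le_one hn0]; linarith [hx1 k]
    have hxξ : x k = n * ξ := by rw [hξ_def]; field_simp
    have hlog := Real.log_nonpos hξ.le hξ1
    have hL : 0 < 1 - Real.log ξ := by linarith
    set G := ξ ^ 2 / (1 - Real.log ξ) with hG_def
    set G' := 2 * ξ / (1 - Real.log ξ) + ξ / (1 - Real.log ξ) ^ 2 with hG'_def
    have hGG' : G ≤ ξ * G' := by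
      have h1 : ξ * G' - G = ξ ^ 2 / (1 - Real.log ξ) + ξ ^ 2 / (1 - Real.log ξ) ^ 2 := by
        rw [hG_def, hG'_def]; field_simp; ring
      have h2 : 0 ≤ ξ ^ 2 / (1 - Real.log ξ) + ξ ^ 2 / (1 - Real.log ξ) ^ 2 :=
        add_nonneg (div_nonneg (sq_nonneg _) hL.le) (div_nonneg (sq_nonneg _) (sq_nonneg _))
      linarith
    have hloss : ∀ t, β * Δ * ((n * G - n * ξ * G') * μ.real (visitAt S k t) +
        G' * ∫ ω in visitAt S k t, q t ω ∂μ) ≤ ∫ ω in visitAt S k t, d t ω ∂μ := by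
      intro t
      have h1 : ∫ ω in visitAt S k t, (β * Δ * (n * G - n * ξ * G') + β * Δ * G' * q t ω) ∂μ
          ≤ ∫ ω in visitAt S k t, d t ω ∂μ := by
        refine setIntegral_mono_on_ae
          ((integrable_const _).add ((hq t).const_mul _)).integrableOn (hd t).integrableOn
          (hat k t) (hmem.mono fun ω hω hωV => ?_)
        have h2 := le_spread_tangent (s := s) hβ0 (hω t) hξ hξ1
        rw [← hG_def, ← hG'_def, ← hn_def] at h2
        have h3 : 1 / 2 < prob (logRate β) p₀ R A L t ω s := hωV.2
        simp only [hd_def, loss, if_pos h3]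
        refine le_trans (le_of_eq ?_) (mul_le_mul_of_nonneg_left h2 hΔ0.le)
        simp only [hq_def]; ring
      rw [integral_add (integrable_const _).integrableOn ((hq t).const_mul _).integrableOn,
        setIntegral_const, integral_const_mul, smul_eq_mul] at h1
      linarith
    have h1 := Finset.sum_le_sum fun t (_ : t ∈ Finset.range T) => hloss t
    rw [← Finset.mul_sum, Finset.sum_add_distrib, ← Finset.mul_sum, ← Finset.mul_sum] at h1
    -- the weights of the visits add up to at most `1`, and the constant term of the tangent
    -- line is nonpositive, so it may be counted with full weight
    have h2 : n * G ≤ (n * G - n * ξ * G') * ∑ t ∈ Finset.range T, μ.real (visitAt S k t) +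
        G' * ∑ t ∈ Finset.range T, ∫ ω in visitAt S k t, q t ω ∂μ := by
      have h3 : ∑ t ∈ Finset.range T, ∫ ω in visitAt S k t, q t ω ∂μ = n * ξ := hxξ
      rw [h3]
      have h4 := mul_nonneg (mul_nonneg hn0.le (sub_nonneg.2 hGG')) (sub_nonneg.2 (hP k))
      linarith
    have h5 := mul_le_mul_of_nonneg_left h2 (by positivity : 0 ≤ β * Δ)
    have h6 := hdrift k T
    have h7 : x (k + 1) = ∑ t ∈ Finset.range T, ∫ ω in visitAt S (k + 1) t, q t ω ∂μ := rfl
    have h8 : x k = ∑ t ∈ Finset.range T, ∫ ω in visitAt S k t, q t ω ∂μ := rfl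
    rw [← h7, ← h8] at h6
    linarith
  have hsum : ∑ t ∈ Finset.range T, ∫ ω in S t, q t ω ∂μ = ∑ k ∈ Finset.range T, x k := by
    rw [hx_def, Finset.sum_comm]
    exact Finset.sum_congr rfl fun t ht =>
      (sum_setIntegral_visitAt hSm (hq t) (Finset.mem_range.1 ht)).symm
  rw [hsum]
  refine (sum_recursion_le (by positivity) hn hx0 hx1 hmono hrec T).trans ?_
  rw [← mul_assoc]
  gcongr

end IsSamba

end Samba

end

theorem theorem2 {ι Ω : Type*} [Fintype ι] [Nontrivial ι]
    [MeasurableSpace ι] [MeasurableSingletonClass ι]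
    [MeasurableSpace Ω] (μ : Measure Ω) [IsProbabilityMeasure μ]
    (r : ι → ℝ) (hr : ∀ a, r a ∈ Set.Icc (0 : ℝ) 1)
    (aStar : ι) (haStar : ∀ a, a ≠ aStar → r a < r aStar)
    (β : ℝ) (hβ : β ∈ Set.Ioc (0 : ℝ) 1)
    (p₀ : ι → ℝ) (hp₀ : p₀ ∈ Samba.openSimplex ι)
    (R : ℕ → ι → Ω → ℝ) (A L : ℕ → Ω → ι)
    (hS : Samba.IsSamba μ r (Samba.logRate β) p₀ R A L) :
    Samba.IsMarkovChain μ (Samba.openSimplex ι)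
        (Samba.transition r (Samba.logRate β)) (Samba.prob (Samba.logRate β) p₀ R A L) ∧
    (∀ᵐ ω ∂μ, Tendsto (fun t => Samba.prob (Samba.logRate β) p₀ R A L t ω aStar)
        atTop (𝓝 1)) ∧
    Summable (fun t : ℕ =>
        μ.real {ω | Samba.prob (Samba.logRate β) p₀ R A L t ω aStar ≤ 1 / 2}) ∧
    ∀ T : ℕ, 1 ≤ T →
      Samba.regret μ r R A T ≤
        (Fintype.card ι : ℝ) / (2 * β * Samba.gap r aStar) *
            Real.log (β * Samba.gap r aStar * T) ^ 2 +
          (∑' t : ℕ, μ.real {ω | Samba.prob (Samba.logRate β) p₀ R A L t ω aStar ≤ 1 / 2}) +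
          (⌈Real.exp 1 / (β * Samba.gap r aStar)⌉ : ℝ) := by
  have hΔ0 := Samba.gap_pos haStar
  have hΔ : ∀ a, a ≠ aStar → Samba.gap r aStar ≤ r aStar - r a := fun a => Samba.gap_le
  have hsum := hS.summable_measureReal_le_half hβ.1 hβ.2 hr hp₀ hΔ0 hΔ
  refine ⟨hS.isMarkovChain hβ.1 hβ.2 hr hp₀, hS.ae_tendsto_one hβ.1 hβ.2 hr hp₀ hΔ0 hΔ, hsum,
    fun T _ => ?_⟩
  have hsplit : ∀ t, ∫ ω, (1 - Samba.prob (Samba.logRate β) p₀ R A L t ω aStar) ∂μ ≤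
      ∫ ω in {ω | 1 / 2 < Samba.prob (Samba.logRate β) p₀ R A L t ω aStar},
        (1 - Samba.prob (Samba.logRate β) p₀ R A L t ω aStar) ∂μ +
      μ.real {ω | Samba.prob (Samba.logRate β) p₀ R A L t ω aStar ≤ 1 / 2} := by
    intro t
    have hm : MeasurableSet {ω | 1 / 2 < Samba.prob (Samba.logRate β) p₀ R A L t ω aStar} :=
      hS.measurable_prob (Samba.measurable_logRate β) t
        (measurableSet_lt measurable_const (measurable_pi_apply aStar))
    have hq : Integrable (fun ω => 1 - Samba.prob (Samba.logRate β) p₀ R A L t ω aStar) μ :=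
      (integrable_const 1).sub (hS.integrable_prob hβ.1 hβ.2 hp₀ t aStar)
    have hc : {ω | 1 / 2 < Samba.prob (Samba.logRate β) p₀ R A L t ω aStar}ᶜ
        = {ω | Samba.prob (Samba.logRate β) p₀ R A L t ω aStar ≤ 1 / 2} := by
      ext ω; simp
    rw [← integral_add_compl hm hq, hc]
    gcongr
    calc ∫ ω in {ω | Samba.prob (Samba.logRate β) p₀ R A L t ω aStar ≤ 1 / 2},
          (1 - Samba.prob (Samba.logRate β) p₀ R A L t ω aStar) ∂μ
        ≤ ∫ _ω in {ω | Samba.prob (Samba.logRate β) p₀ R A L t ω aStar ≤ 1 / 2}, (1 : ℝ) ∂μ := by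
          refine setIntegral_mono_ae hq.integrableOn (integrable_const _).integrableOn ?_
          filter_upwards [hS.ae_prob_mem hβ.1 hβ.2 hp₀] with ω hω
          linarith [(hω t).1 aStar]
      _ = _ := by simp
  have h1 := hS.regret_le_sum hβ.1 hβ.2 hr hp₀ haStar T
  have h2 := Finset.sum_le_sum fun t (_ : t ∈ Finset.range T) => hsplit t
  rw [Finset.sum_add_distrib] at h2
  have h3 := hS.sum_setIntegral_le hβ.1 hβ.2 hr hp₀ hΔ0 hΔ T
  have h4 := hsum.sum_le_tsum (Finset.range T) fun t _ => measureReal_nonneg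
  linarith
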